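/- Let $G=(V,E)$ be a finite graph with $n$ vertices. For $k\in\mathbb{N}$, a partial conflict-free colouring of $G$ with $k$ colours and open neighbourhoods is a map $C:V\to\{0,1,\dots,k\}$ such that for every $v\in V$ there is a colour $i\in\{1,\dots,k\}$ with $|N(v)\cap C^{-1}(i)|=1$; the closed-neighbourhood version has $N[v]=N(v)\cup\{v\}$ in place of $N(v)$, and a full conflict-free colouring is one in which no vertex receives colour $0$. Let $\chi^*_{ON}(G)$, $\chi^*_{CN}(G)$ (partial) and $\chi_{ON}(G)$, $\chi_{CN}(G)$ (full) be the least numbers of colours of such colourings, with value $\infty$ if there is none. A $w$-expression $\Phi$ of $G$ is an expression that builds $G$, with vertex labels in $\{1,\dots,w\}$, by the operations: introduce a vertex $v$ with label $i$; disjoint union; relabel $i$ to $j$; join all vertices of label $i$ to all vertices of label $j$ (where $i\neq j$). Let $|\Phi|$ be the number of operations in $\Phi$. Theorem. For each $\chi\in\{\chi^*_{ON},\chi^*_{CN},\chi_{ON},\chi_{CN}\}$ there is one algorithm (for a random access machine with addition and subtraction) that, given a graph $G$, a $w$-expression $\Phi$ of $G$ and $k\in\mathbb{N}$, decides whether $\chi(G)\le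 k$ in time $2^{O(w\cdot 3^k)}\,|\Phi|^{O(1)}$. If $|\Phi|=O(nw^2)$, which may be assumed without loss of generality, the same algorithm runs in time $2^{O(w\cdot 3^k)}\,n^{O(1)}$. -/

import Mathlib

namespace CF

/-! ## Conflict-free colourings -/

section Colouring

variable {V : Type*}

/-- The open neighbourhood `N(v)`. -/
def openNbhd (G : SimpleGraph V) (v : V) : Set V := G.neighborSet v

/-- The closed neighbourhood `N[v] = N(v) ∪ {v}`. -/
def closedNbhd (G : SimpleGraph V) (v : V) : Set V := G.neighborSet v ∪ {v}

/-- `C : V → {0, 1, …, k}` is a (partial) conflict-free colouring with respect to the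
neighbourhoods `N`: every `v` has a colour `i ∈ {1, …, k}` that occurs exactly once in `N v`.
Vertices of colour `0` are uncoloured. -/
def IsPartialColouring (N : V → Set V) (k : ℕ) (C : V → ℕ) : Prop :=
  (∀ v, C v ≤ k) ∧ ∀ v, ∃ i, 1 ≤ i ∧ i ≤ k ∧ (N v ∩ C ⁻¹' {i}).ncard = 1

/-- `C : V → {1, …, k}` is a full conflict-free colouring with respect to the
neighbourhoods `N`. -/
def IsFullColouring (N : V → Set V) (k : ℕ) (C : V → ℕ) : Prop :=
  (∀ v, 1 ≤ C v ∧ C v ≤ k) ∧ ∀ v, ∃ i, 1 ≤ i ∧ i ≤ k ∧ (N v ∩ C ⁻¹' {i}).ncard = 1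

/-- The smallest number of colours of a partial conflict-free colouring with open
neighbourhoods; it is `⊤` if there is no such colouring. -/
noncomputable def chiONStar (G : SimpleGraph V) : ℕ∞ :=
  ⨅ k ∈ {k : ℕ | ∃ C, IsPartialColouring (openNbhd G) k C}, (k : ℕ∞)

/-- The smallest number of colours of a partial conflict-free colouring with closed
neighbourhoods. -/
noncomputable def chiCNStar (G : SimpleGraph V) : ℕ∞ :=
  ⨅ k ∈ {k : ℕ | ∃ C, IsPartialColouring (closedNbhd G) k C}, (k : ℕ∞)

/-- The smallest number of colours of a full conflict-free colouring with open
neighbourhoods; it is `⊤` if there is no such colouring. -/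
noncomputable def chiON (G : SimpleGraph V) : ℕ∞ :=
  ⨅ k ∈ {k : ℕ | ∃ C, IsFullColouring (openNbhd G) k C}, (k : ℕ∞)

/-- The smallest number of colours of a full conflict-free colouring with closed
neighbourhoods. -/
noncomputable def chiCN (G : SimpleGraph V) : ℕ∞ :=
  ⨅ k ∈ {k : ℕ | ∃ C, IsFullColouring (closedNbhd G) k C}, (k : ℕ∞)

end Colouring

/-! ## Clique-width expressions -/

/-- The terms of the clique-width algebra with labels in `Fin w` and vertices named by
elements of `V`. -/
inductive CWExpr (V : Type*) (w : ℕ) where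
  /-- introduce the vertex `v` with label `i` -/
  | vertex (v : V) (i : Fin w) : CWExpr V w
  /-- disjoint union -/
  | union (Φ Ψ : CWExpr V w) : CWExpr V w
  /-- relabel `i` to `j` -/
  | relabel (i j : Fin w) (hij : i ≠ j) (Φ : CWExpr V w) : CWExpr V w
  /-- add all edges between label `i` and label `j` -/
  | join (i j : Fin w) (hij : i ≠ j) (Φ : CWExpr V w) : CWExpr V w

namespace CWExpr

variable {V : Type*} {w : ℕ}

/-- The label of `u` in the graph of the expression; `none` if `u` is not a vertex of it. -/
def label [DecidableEq V] : CWExpr V w → V → Option (Fin w)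
  | vertex v i, u => if u = v then some i else none
  | union Φ Ψ, u => (Φ.label u).or (Ψ.label u)
  | relabel i j _ Φ, u => (Φ.label u).map fun a => if a = i then j else a
  | join _ _ _ Φ, u => Φ.label u

/-- The edges of the graph of the expression. -/
def graph [DecidableEq V] : CWExpr V w → SimpleGraph V
  | vertex _ _ => ⊥
  | union Φ Ψ => Φ.graph ⊔ Ψ.graph
  | relabel _ _ _ Φ => Φ.graph
  | join i j _ Φ =>
      Φ.graph ⊔ SimpleGraph.fromRel fun u v => Φ.label u = some i ∧ Φ.label v = some j

/-- All unions in the expression are disjoint unions. -/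
def Valid [DecidableEq V] : CWExpr V w → Prop
  | vertex _ _ => True
  | union Φ Ψ => Φ.Valid ∧ Ψ.Valid ∧ ∀ u, Φ.label u = none ∨ Ψ.label u = none
  | relabel _ _ _ Φ => Φ.Valid
  | join _ _ _ Φ => Φ.Valid

/-- `Φ` is a `w`-expression of the graph `G` with vertex set `V`. -/
def Defines [DecidableEq V] (Φ : CWExpr V w) (G : SimpleGraph V) : Prop :=
  Φ.Valid ∧ (∀ v, Φ.label v ≠ none) ∧ Φ.graph = G

/-- The number of operations of an expression. -/
def size : CWExpr V w → ℕ
  | vertex _ _ => 1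
  | union Φ Ψ => Φ.size + Ψ.size + 1
  | relabel _ _ _ Φ => Φ.size + 1
  | join _ _ _ Φ => Φ.size + 1

/-- The operations of an expression in postfix order, three numbers for each of them. -/
def encode {n : ℕ} : CWExpr (Fin n) w → List ℕ
  | vertex v i => [0, (v : ℕ), (i : ℕ)]
  | union Φ Ψ => Φ.encode ++ Ψ.encode ++ [1, 0, 0]
  | relabel i j _ Φ => Φ.encode ++ [2, (i : ℕ), (j : ℕ)]
  | join i j _ Φ => Φ.encode ++ [3, (i : ℕ), (j : ℕ)]

end CWExpr

open Classical in
/-- The adjacency matrix of a graph on `{0, …, n - 1}`, row by row. -/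
noncomputable def encodeGraph {n : ℕ} (G : SimpleGraph (Fin n)) : List ℕ :=
  (List.finRange n).flatMap fun u => (List.finRange n).map fun v => if G.Adj u v then 1 else 0

/-- The input: `n`, `w`, `k`, the number of operations, the expression, and the adjacency
matrix. -/
noncomputable def encodeInstance {n w : ℕ} (G : SimpleGraph (Fin n)) (Φ : CWExpr (Fin n) w)
    (k : ℕ) : List ℕ :=
  [n, w, k, Φ.size] ++ Φ.encode ++ encodeGraph G

/-! ## Random access machines

A random access machine with finitely many registers named in its program, an infinite memory
with indirect addressing, and read-only random access to its input. Addition and truncated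
subtraction are the only arithmetic operations, and every instruction and every test costs one
step (without multiplication, this time measure agrees with Turing machine time up to a
polynomial). -/

/-- Structured programs of the machine. -/
inductive Prog where
  /-- `reg x := c` -/
  | const (x c : ℕ) : Prog
  /-- `reg x := reg y` -/
  | copy (x y : ℕ) : Prog
  /-- `reg x := reg y + reg z` -/
  | plus (x y z : ℕ) : Prog
  /-- `reg x := reg y - reg z`, truncated at `0` -/
  | minus (x y z : ℕ) : Prog
  /-- `reg x := mem (reg y)` -/
  | load (x y : ℕ) : Prog
  /-- `mem (reg x) := reg y` -/
  | store (x y : ℕ) : Prog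
  /-- `reg x := input (reg y)`, which is `0` beyond the end of the input -/
  | read (x y : ℕ) : Prog
  /-- sequential composition -/
  | seq (P Q : Prog) : Prog
  /-- `if reg x ≠ 0 then P else Q` -/
  | cond (x : ℕ) (P Q : Prog) : Prog
  /-- `while reg x ≠ 0 do P` -/
  | loop (x : ℕ) (P : Prog) : Prog

/-- Contents of the registers and of the memory. -/
structure Store where
  reg : ℕ → ℕ
  mem : ℕ → ℕ

namespace Store

/-- All registers and memory cells hold `0`. -/
def init : Store := ⟨fun _ => 0, fun _ => 0⟩

/-- Assign a value to a register. -/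
def setReg (s : Store) (x a : ℕ) : Store := ⟨Function.update s.reg x a, s.mem⟩

/-- Assign a value to a memory cell. -/
def setMem (s : Store) (p a : ℕ) : Store := ⟨s.reg, Function.update s.mem p a⟩

end Store

/-- `Exec input P s s' t`: on the given input, the program `P` started in `s` halts in `s'` after
exactly `t` steps. -/
inductive Exec (input : List ℕ) : Prog → Store → Store → ℕ → Prop where
  | const (s : Store) (x c : ℕ) : Exec input (.const x c) s (s.setReg x c) 1
  | copy (s : Store) (x y : ℕ) : Exec input (.copy x y) s (s.setReg x (s.reg y)) 1
  | plus (s : Store) (x y z : ℕ) :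
      Exec input (.plus x y z) s (s.setReg x (s.reg y + s.reg z)) 1
  | minus (s : Store) (x y z : ℕ) :
      Exec input (.minus x y z) s (s.setReg x (s.reg y - s.reg z)) 1
  | load (s : Store) (x y : ℕ) : Exec input (.load x y) s (s.setReg x (s.mem (s.reg y))) 1
  | store (s : Store) (x y : ℕ) : Exec input (.store x y) s (s.setMem (s.reg x) (s.reg y)) 1
  | read (s : Store) (x y : ℕ) :
      Exec input (.read x y) s (s.setReg x (input.getD (s.reg y) 0)) 1
  | seq {P Q : Prog} {s s' s'' : Store} {t t' : ℕ} (hP : Exec input P s s' t)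
      (hQ : Exec input Q s' s'' t') : Exec input (.seq P Q) s s'' (t + t')
  | cond_true {x : ℕ} {P Q : Prog} {s s' : Store} {t : ℕ} (hx : s.reg x ≠ 0)
      (hP : Exec input P s s' t) : Exec input (.cond x P Q) s s' (t + 1)
  | cond_false {x : ℕ} {P Q : Prog} {s s' : Store} {t : ℕ} (hx : s.reg x = 0)
      (hQ : Exec input Q s s' t) : Exec input (.cond x P Q) s s' (t + 1)
  | loop_done {x : ℕ} {P : Prog} {s : Store} (hx : s.reg x = 0) : Exec input (.loop x P) s s 1
  | loop_step {x : ℕ} {P : Prog} {s s' s'' : Store} {t t' : ℕ} (hx : s.reg x ≠ 0)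
      (hP : Exec input P s s' t) (hL : Exec input (.loop x P) s' s'' t') :
      Exec input (.loop x P) s s'' (t + t' + 1)

/-- On the given input, the program `P` halts within `T` steps, and it answers correctly whether
`Q` holds: its answer, in register `0`, is `1` for yes and `0` for no. -/
def DecidesWithin (P : Prog) (input : List ℕ) (T : ℕ) (Q : Prop) : Prop :=
  ∃ s t, Exec input P Store.init s t ∧ t ≤ T ∧ ((Q ∧ s.reg 0 = 1) ∨ (¬ Q ∧ s.reg 0 = 0))

/-- There is one algorithm that, given a graph `G` with `n` vertices, a `w`-expression `Φ` of `G`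
and a number `k`, decides whether `χ G ≤ k`
* in time `2 ^ O(w * 3 ^ k) * |Φ| ^ O(1)`, for the number `|Φ|` of operations of `Φ`, and
* in time `2 ^ O(w * 3 ^ k) * n ^ O(1)` on all `Φ` with `O(n * w ^ 2)` operations. -/
def DecidableWithExpression (χ : ∀ {n : ℕ}, SimpleGraph (Fin n) → ℕ∞) : Prop :=
  ∃ P : Prog,
    (∃ c : ℕ, ∀ (n w k : ℕ) (G : SimpleGraph (Fin n)) (Φ : CWExpr (Fin n) w), Φ.Defines G →
      DecidesWithin P (encodeInstance G Φ k) (2 ^ (c * (w * 3 ^ k)) * Φ.size ^ c) (χ G ≤ k)) ∧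
    ∀ b : ℕ, ∃ c : ℕ, ∀ (n w k : ℕ) (G : SimpleGraph (Fin n)) (Φ : CWExpr (Fin n) w),
      Φ.Defines G → Φ.size ≤ b * (n * w ^ 2) →
      DecidesWithin P (encodeInstance G Φ k) (2 ^ (c * (w * 3 ^ k)) * n ^ c) (χ G ≤ k)

end CF

/-! The algorithm is a dynamic program over the operations of the expression in postfix order. For a
subexpression, a state records, for each label, the number of vertices of each colour truncated at
2, and the set of colour vectors (neighbour counts per colour, truncated at 2) that occur at
vertices with this label. Truncation at 2 is harmless: it still distinguishes the count 1, and it is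
compatible with addition (`min_add_sum_min`). With `k + 3 ^ k ≤ 2 * 3 ^ k` ternary digits per label
there are at most `3 ^ (2 * w * 3 ^ k)` states.

The main device is that neighbourhoods are always taken in the final graph `G`, restricted to the
vertices already present. A join then changes no state, even if it repeats existing edges, and the
edges have to be accounted for at unions. This works because a later operation cannot distinguish
vertices with the same label: whether `G` joins two vertices from different sides of a union depends
only on their labels (`uniform_of_adj_iff`). One look at the labels and the adjacency matrix
therefore tells which pairs of classes will be joined, and the new neighbours of a vertex are
counted class by class (`nbhdCard_add`). The recursions for the realizable states are
`realizable_vertex`, `realizable_relabel` and `realizable_union`; at the root, a conflict-free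
colouring exists iff some realizable state has only colour vectors with an entry 1
(`exists_goodState_iff`).

For the machine, the table is a single array filled by course-of-values recursion. Every loop of the
term that computes an entry runs the same number `B` of times, where `B = |Φ| ^ 2 * 3 ^ (2 * w * 3 ^
k + 1)` exceeds every quantity that has to be enumerated. The term is fixed, so the cost of an entry
is at most `(B + 2) ^ D` with `D` independent of the input (`cost_le_pow`), and the same holds with
another `D` for the whole run (`run_tableProg`). Crude loops and brute-force searches thus cost only
a constant in the exponents of `2 ^ O(w * 3 ^ k) * |Φ| ^ O(1)` (`time_le`). The bound in terms of
`n` follows from `w ≤ 2 ^ (w * 3 ^ k)`.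

All four variants are treated at once: `cl` selects closed or open neighbourhoods, and `lo` is the
least colour allowed, 0 for partial and 1 for full colourings. -/

namespace CF

/-! ## Running programs with a bound on the time -/

/-- The program `P` halts when started in `s`, within `T` steps and in the store `s'`. -/
def Run (input : List ℕ) (P : Prog) (s s' : Store) (T : ℕ) : Prop :=
  ∃ t ≤ T, Exec input P s s' t

namespace Run

variable {input : List ℕ} {P Q : Prog} {s s' s'' : Store} {T T' : ℕ}

theorem of_exec (h : Exec input P s s' T) : Run input P s s' T := ⟨T, le_rfl, h⟩

theorem mono (h : Run input P s s' T) (hT : T ≤ T') : Run input P s s' T' :=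
  let ⟨t, ht, e⟩ := h; ⟨t, ht.trans hT, e⟩

theorem seq (h : Run input P s s' T) (h' : Run input Q s' s'' T') :
    Run input (.seq P Q) s s'' (T + T') :=
  let ⟨_, ht, e⟩ := h; let ⟨_, ht', e'⟩ := h'; ⟨_, Nat.add_le_add ht ht', .seq e e'⟩

theorem cond_true {x : ℕ} (hx : s.reg x ≠ 0) (h : Run input P s s' T) :
    Run input (.cond x P Q) s s' (T + 1) :=
  let ⟨_, ht, e⟩ := h; ⟨_, Nat.add_le_add_right ht 1, .cond_true hx e⟩

theorem cond_false {x : ℕ} (hx : s.reg x = 0) (h : Run input Q s s' T) :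
    Run input (.cond x P Q) s s' (T + 1) :=
  let ⟨_, ht, e⟩ := h; ⟨_, Nat.add_le_add_right ht 1, .cond_false hx e⟩

/-- A loop that counts the register `r` down to `0`. -/
theorem countdown {r : ℕ} (I : ℕ → Store → Prop)
    (step : ∀ i s, I i s → s.reg r ≠ 0 →
      ∃ s', Run input P s s' T ∧ I (i + 1) s' ∧ s'.reg r = s.reg r - 1) :
    ∀ (N i : ℕ) (s : Store), I i s → s.reg r = N →
      ∃ s', Run input (.loop r P) s s' (N * (T + 1) + 1) ∧ I (i + N) s' := by
  intro N
  induction N with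
  | zero => exact fun i s hI hr => ⟨s, by simpa using of_exec (.loop_done hr), hI⟩
  | succ N ih =>
    intro i s hI hr
    obtain ⟨s₁, ⟨t₁, ht₁, e₁⟩, hI₁, hr₁⟩ := step i s hI (by omega)
    obtain ⟨s₂, ⟨t₂, ht₂, e₂⟩, hI₂⟩ := ih (i + 1) s₁ hI₁ (by omega)
    refine ⟨s₂, ⟨t₁ + t₂ + 1, ?_, .loop_step (by omega) e₁ e₂⟩, ?_⟩
    · have : (N + 1) * (T + 1) = N * (T + 1) + (T + 1) := by ring
      omega
    · rwa [Nat.add_assoc, Nat.add_comm 1 N] at hI₂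

end Run

/-! ## A language of arithmetic terms with bounded loops -/

/-- Terms that denote numbers, relative to a list of values for the variables. -/
inductive Tm where
  | var (i : ℕ) : Tm
  | const (c : ℕ) : Tm
  /-- the number of iterations of every loop -/
  | bound : Tm
  | add (a b : Tm) : Tm
  | sub (a b : Tm) : Tm
  | read (a : Tm) : Tm
  | load (a : Tm) : Tm
  | ite (c a b : Tm) : Tm
  /-- `y := a; for i < bound do y := y + f`, where `f` can access `i`, and `y` if `vis` is set -/
  | loop (vis : Bool) (a f : Tm) : Tm
  /-- pass one more argument to `f` -/
  | app (f a : Tm) : Tm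
  /-- evaluate `t` at the arguments instead of the variables -/
  | fn (t : Tm) : Tm

/-- The data that terms can access: input, memory, and the number of iterations of loops. -/
structure Mach where
  inp : ℕ → ℕ
  mem : ℕ → ℕ
  bd : ℕ

/-- The result of `y := a; for i < n do y := y + f i y`. -/
def accum (f : ℕ → ℕ → ℕ) (a : ℕ) : ℕ → ℕ
  | 0 => a
  | n + 1 => accum f a n + f n (accum f a n)

namespace Tm

/-- The value of a term at the values `e` of the variables and at the arguments `σ`. -/
def eval (M : Mach) : Tm → List ℕ → List ℕ → ℕ
  | var i, e, _ => e.getD i 0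
  | const c, _, _ => c
  | bound, _, _ => M.bd
  | add a b, e, _ => a.eval M e [] + b.eval M e []
  | sub a b, e, _ => a.eval M e [] - b.eval M e []
  | read a, e, _ => M.inp (a.eval M e [])
  | load a, e, _ => M.mem (a.eval M e [])
  | ite c a b, e, _ => if c.eval M e [] = 0 then b.eval M e [] else a.eval M e []
  | loop vis a f, e, _ =>
      accum (fun i y => f.eval M (i :: if vis then y :: e else e) []) (a.eval M e []) M.bd
  | app f a, e, σ => f.eval M e (a.eval M e [] :: σ)
  | fn t, _, σ => t.eval M σ []

/-- A program that stores the value of a term in register `d` and changes no lower register. The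
values of the variables are in the registers `ρ`, the arguments in the registers `σ`, and the number
of iterations in register `1`. -/
def compile : Tm → List ℕ → List ℕ → ℕ → Prog
  | var i, ρ, _, d => if h : i < ρ.length then .copy d ρ[i] else .const d 0
  | const c, _, _, d => .const d c
  | bound, _, _, d => .copy d 1
  | add a b, ρ, _, d => .seq (a.compile ρ [] d) (.seq (b.compile ρ [] (d + 1)) (.plus d d (d + 1)))
  | sub a b, ρ, _, d => .seq (a.compile ρ [] d) (.seq (b.compile ρ [] (d + 1)) (.minus d d (d + 1)))
  | read a, ρ, _, d => .seq (a.compile ρ [] d) (.read d d)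
  | load a, ρ, _, d => .seq (a.compile ρ [] d) (.load d d)
  | ite c a b, ρ, _, d =>
      .seq (c.compile ρ [] d) (.cond d (a.compile ρ [] d) (b.compile ρ [] d))
  | loop vis a f, ρ, _, d =>
      .seq (a.compile ρ [] d) (.seq (.const (d + 1) 0) (.seq (.copy (d + 2) 1)
        (.seq (.const (d + 3) 1) (.loop (d + 2)
          (.seq (f.compile ((d + 1) :: if vis then d :: ρ else ρ) [] (d + 4))
            (.seq (.plus d d (d + 4)) (.seq (.plus (d + 1) (d + 1) (d + 3))
              (.minus (d + 2) (d + 2) (d + 3)))))))))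
  | app f a, ρ, σ, d =>
      .seq (a.compile ρ [] d) (.seq (f.compile ρ (d :: σ) (d + 1)) (.copy d (d + 1)))
  | fn t, _, σ, d => t.compile σ [] d

/-- A bound on the time of the program, for the number `B` of iterations. -/
def cost : Tm → ℕ → ℕ
  | var _, _ => 1
  | const _, _ => 1
  | bound, _ => 1
  | add a b, B => a.cost B + (b.cost B + 1)
  | sub a b, B => a.cost B + (b.cost B + 1)
  | read a, B => a.cost B + 1
  | load a, B => a.cost B + 1
  | ite c a b, B => c.cost B + (a.cost B + b.cost B + 1)
  | loop _ a f, B => a.cost B + (1 + (1 + (1 + (B * (f.cost B + (1 + (1 + 1)) + 1) + 1))))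
  | app f a, B => a.cost B + (f.cost B + 1)
  | fn t, B => t.cost B

/-- Functions dominated by a power of `B + 2` are closed under sums and products, and a loop
multiplies by `B`. The base is at least 2, so one extra power absorbs the factor 2 of a sum, also
for `B = 0`. -/
theorem cost_le_pow (t : Tm) : ∃ D, ∀ B, t.cost B ≤ (B + 2) ^ D := by
  have key : ∀ D D' B : ℕ, ∀ x y : ℕ, x ≤ (B + 2) ^ D → y ≤ (B + 2) ^ D' →
      x + y ≤ (B + 2) ^ (D + D' + 1) ∧ x * y ≤ (B + 2) ^ (D + D' + 1) := by
    intro D D' B x y hx hy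
    have h1 : 1 ≤ (B + 2) ^ D := Nat.one_le_pow _ _ (by omega)
    have h2 : 1 ≤ (B + 2) ^ D' := Nat.one_le_pow _ _ (by omega)
    have h3 : (B + 2) ^ (D + D' + 1) = (B + 2) ^ D * (B + 2) ^ D' * (B + 2) := by
      rw [pow_succ, pow_add]
    rw [h3]
    constructor
    · have h4 : (B + 2) ^ D ≤ (B + 2) ^ D * (B + 2) ^ D' := Nat.le_mul_of_pos_right _ h2
      have h5 : (B + 2) ^ D' ≤ (B + 2) ^ D * (B + 2) ^ D' := Nat.le_mul_of_pos_left _ h1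
      have h6 : (B + 2) ^ D * (B + 2) ^ D' * 2 ≤ (B + 2) ^ D * (B + 2) ^ D' * (B + 2) :=
        Nat.mul_le_mul_left _ (by omega)
      omega
    · calc x * y ≤ (B + 2) ^ D * (B + 2) ^ D' := Nat.mul_le_mul hx hy
        _ ≤ _ := Nat.le_mul_of_pos_right _ (by omega)
  have one : ∃ D, ∀ B : ℕ, 1 ≤ (B + 2) ^ D := ⟨0, fun B => by simp⟩
  have sum : ∀ f g : ℕ → ℕ, (∃ D, ∀ B, f B ≤ (B + 2) ^ D) → (∃ D, ∀ B, g B ≤ (B + 2) ^ D) →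
      ∃ D, ∀ B, f B + g B ≤ (B + 2) ^ D :=
    fun f g ⟨D, h⟩ ⟨D', h'⟩ => ⟨_, fun B => (key D D' B _ _ (h B) (h' B)).1⟩
  have prod : ∀ f g : ℕ → ℕ, (∃ D, ∀ B, f B ≤ (B + 2) ^ D) → (∃ D, ∀ B, g B ≤ (B + 2) ^ D) →
      ∃ D, ∀ B, f B * g B ≤ (B + 2) ^ D :=
    fun f g ⟨D, h⟩ ⟨D', h'⟩ => ⟨_, fun B => (key D D' B _ _ (h B) (h' B)).2⟩
  induction t with
  | var | const | bound => exact one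
  | add a b iha ihb | sub a b iha ihb | app a b ihb iha =>
    exact sum _ _ iha (sum _ _ ihb one)
  | read a ih | load a ih => exact sum _ _ ih one
  | ite c a b ihc iha ihb => exact sum _ _ ihc (sum _ _ (sum _ _ iha ihb) one)
  | fn t ih => exact ih
  | loop _ a f iha ihf =>
    refine sum _ _ iha (sum _ _ one (sum _ _ one (sum _ _ one (sum _ _ (prod _ _ ⟨1, ?_⟩
      (sum _ _ (sum _ _ ihf (sum _ _ one (sum _ _ one one))) one)) one))))
    intro B; rw [pow_one]; omega

theorem map_reg_congr {s s' : Store} {ρ : List ℕ} {d : ℕ} (hρ : ∀ r ∈ ρ, r < d)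
    (h : ∀ r < d, s'.reg r = s.reg r) : ρ.map s'.reg = ρ.map s.reg :=
  List.map_congr_left fun r hr => h r (hρ r hr)

/-- Registers from `d` upwards serve as a stack: a subterm works above all values still needed, and
`2 ≤ d` protects the iteration count in register 1. Compiled terms never write to memory, so all
subterms are evaluated over the same data. -/
theorem run_compile (input : List ℕ) (t : Tm) :
    ∀ (ρ σ : List ℕ) (d : ℕ) (s : Store), 2 ≤ d → (∀ r ∈ ρ, r < d) → (∀ r ∈ σ, r < d) →
      ∃ s', Run input (t.compile ρ σ d) s s' (t.cost (s.reg 1)) ∧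
        s'.reg d = t.eval ⟨fun i => input.getD i 0, s.mem, s.reg 1⟩ (ρ.map s.reg) (σ.map s.reg) ∧
        s'.mem = s.mem ∧ ∀ r < d, s'.reg r = s.reg r := by
  have upd : ∀ (s : Store) (d a : ℕ), (s.setReg d a).reg d = a ∧ (s.setReg d a).mem = s.mem ∧
      ∀ r < d, (s.setReg d a).reg r = s.reg r := fun s d a =>
    ⟨by simp [Store.setReg], rfl, fun r hr => by simp [Store.setReg, hr.ne]⟩
  induction t with
  | var i =>
    intro ρ σ d s hd hρ hσ
    by_cases h : i < ρ.length
    · refine ⟨s.setReg d (s.reg ρ[i]), ?_, ?_, (upd _ _ _).2⟩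
      · simp only [compile, h, dif_pos]; exact .of_exec (.copy _ _ _)
      · simp [Store.setReg, eval, h]
    · refine ⟨s.setReg d 0, ?_, ?_, (upd _ _ _).2⟩
      · simp only [compile, h, dif_neg, not_false_iff]; exact .of_exec (.const _ _ _)
      · simp [Store.setReg, eval, h]
  | const c =>
    intro ρ σ d s hd hρ hσ
    exact ⟨s.setReg d c, .of_exec (.const _ _ _), upd _ _ _⟩
  | bound =>
    intro ρ σ d s hd hρ hσ
    exact ⟨s.setReg d (s.reg 1), .of_exec (.copy _ _ _), upd _ _ _⟩
  | read a ih =>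
    intro ρ σ d s hd hρ hσ
    obtain ⟨s₁, r₁, e₁, m₁, f₁⟩ := ih ρ [] d s hd hρ (by simp)
    refine ⟨s₁.setReg d (input.getD (s₁.reg d) 0), r₁.seq (.of_exec (.read _ _ _)), ?_, m₁, ?_⟩
    · rw [(upd _ _ _).1, e₁]; rfl
    · intro r hr; rw [(upd _ _ _).2.2 r hr, f₁ r hr]
  | load a ih =>
    intro ρ σ d s hd hρ hσ
    obtain ⟨s₁, r₁, e₁, m₁, f₁⟩ := ih ρ [] d s hd hρ (by simp)
    refine ⟨s₁.setReg d (s₁.mem (s₁.reg d)), r₁.seq (.of_exec (.load _ _ _)), ?_, m₁, ?_⟩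
    · rw [(upd _ _ _).1, e₁, m₁]; rfl
    · intro r hr; rw [(upd _ _ _).2.2 r hr, f₁ r hr]
  | add a b iha ihb =>
    intro ρ σ d s hd hρ hσ
    obtain ⟨s₁, r₁, e₁, m₁, f₁⟩ := iha ρ [] d s hd hρ (by simp)
    obtain ⟨s₂, r₂, e₂, m₂, f₂⟩ := ihb ρ [] (d + 1) s₁ (by omega)
      (fun r hr => (hρ r hr).trans (Nat.lt_succ_self d)) (by simp)
    rw [map_reg_congr hρ f₁, m₁, f₁ 1 (by omega)] at e₂
    rw [f₁ 1 (by omega)] at r₂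
    refine ⟨s₂.setReg d (s₂.reg d + s₂.reg (d + 1)), r₁.seq (r₂.seq (.of_exec (.plus _ _ _ _))),
      ?_, m₂.trans m₁, ?_⟩
    · rw [(upd _ _ _).1, e₂, f₂ d (by omega), e₁]; rfl
    · intro r hr; rw [(upd _ _ _).2.2 r hr, f₂ r (by omega), f₁ r hr]
  | sub a b iha ihb =>
    intro ρ σ d s hd hρ hσ
    obtain ⟨s₁, r₁, e₁, m₁, f₁⟩ := iha ρ [] d s hd hρ (by simp)
    obtain ⟨s₂, r₂, e₂, m₂, f₂⟩ := ihb ρ [] (d + 1) s₁ (by omega)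
      (fun r hr => (hρ r hr).trans (Nat.lt_succ_self d)) (by simp)
    rw [map_reg_congr hρ f₁, m₁, f₁ 1 (by omega)] at e₂
    rw [f₁ 1 (by omega)] at r₂
    refine ⟨s₂.setReg d (s₂.reg d - s₂.reg (d + 1)), r₁.seq (r₂.seq (.of_exec (.minus _ _ _ _))),
      ?_, m₂.trans m₁, ?_⟩
    · rw [(upd _ _ _).1, e₂, f₂ d (by omega), e₁]; rfl
    · intro r hr; rw [(upd _ _ _).2.2 r hr, f₂ r (by omega), f₁ r hr]
  | ite c a b ihc iha ihb =>
    intro ρ σ d s hd hρ hσ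
    obtain ⟨s₁, r₁, e₁, m₁, f₁⟩ := ihc ρ [] d s hd hρ (by simp)
    by_cases h : s₁.reg d = 0
    · obtain ⟨s₂, r₂, e₂, m₂, f₂⟩ := ihb ρ [] d s₁ hd hρ (by simp)
      rw [map_reg_congr hρ f₁, m₁, f₁ 1 (by omega)] at e₂
      rw [f₁ 1 (by omega)] at r₂
      refine ⟨s₂, r₁.seq ((r₂.cond_false h).mono (by omega)), ?_, m₂.trans m₁,
        fun r hr => (f₂ r hr).trans (f₁ r hr)⟩
      rw [e₂]; rw [e₁] at h; simp only [eval]; rw [List.map_nil] at h; rw [if_pos h]; rfl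
    · obtain ⟨s₂, r₂, e₂, m₂, f₂⟩ := iha ρ [] d s₁ hd hρ (by simp)
      rw [map_reg_congr hρ f₁, m₁, f₁ 1 (by omega)] at e₂
      rw [f₁ 1 (by omega)] at r₂
      refine ⟨s₂, r₁.seq ((r₂.cond_true h).mono (by omega)), ?_, m₂.trans m₁,
        fun r hr => (f₂ r hr).trans (f₁ r hr)⟩
      rw [e₂]; rw [e₁] at h; simp only [eval]; rw [List.map_nil] at h; rw [if_neg h]; rfl
  | app f a ihf iha =>
    intro ρ σ d s hd hρ hσ
    obtain ⟨s₁, r₁, e₁, m₁, f₁⟩ := iha ρ [] d s hd hρ (by simp)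
    obtain ⟨s₂, r₂, e₂, m₂, f₂⟩ := ihf ρ (d :: σ) (d + 1) s₁ (by omega)
      (fun r hr => (hρ r hr).trans (Nat.lt_succ_self d)) (by
        intro r hr
        rcases List.mem_cons.1 hr with rfl | hr
        · omega
        · exact (hσ r hr).trans (Nat.lt_succ_self d))
    rw [map_reg_congr hρ f₁, m₁, f₁ 1 (by omega), List.map_cons, map_reg_congr hσ f₁, e₁] at e₂
    rw [f₁ 1 (by omega)] at r₂
    refine ⟨s₂.setReg d (s₂.reg (d + 1)), r₁.seq (r₂.seq (.of_exec (.copy _ _ _))),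
      ?_, m₂.trans m₁, ?_⟩
    · rw [(upd _ _ _).1, e₂]; rfl
    · intro r hr; rw [(upd _ _ _).2.2 r hr, f₂ r (by omega), f₁ r hr]
  | fn t ih =>
    intro ρ σ d s hd hρ hσ
    exact ih σ [] d s hd hσ (by simp)
  | loop vis a f iha ihf =>
    intro ρ σ d s hd hρ hσ
    obtain ⟨s₁, r₁, e₁, m₁, f₁⟩ := iha ρ [] d s hd hρ (by simp)
    set M : Mach := ⟨fun i => input.getD i 0, s.mem, s.reg 1⟩ with hM
    set e := ρ.map s.reg with he
    let F : ℕ → ℕ → ℕ := fun i y => f.eval M (i :: if vis then y :: e else e) []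
    -- Register `d` is the accumulator, `d + 1` the index and `d + 3` the constant 1. The remaining
    -- count in `d + 2` is tracked by `Run.countdown`.
    let I : ℕ → Store → Prop := fun i u =>
      u.reg d = accum F (a.eval M e []) i ∧ u.reg (d + 1) = i ∧ u.reg (d + 3) = 1 ∧
        u.mem = s.mem ∧ ∀ r < d, u.reg r = s.reg r
    obtain ⟨s₂, r₂, h₂⟩ := Run.countdown (input := input) (r := d + 2)
      (P := .seq (f.compile ((d + 1) :: if vis then d :: ρ else ρ) [] (d + 4))
            (.seq (.plus d d (d + 4)) (.seq (.plus (d + 1) (d + 1) (d + 3))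
              (.minus (d + 2) (d + 2) (d + 3)))))
      (T := f.cost (s.reg 1) + (1 + (1 + 1))) I (by
        rintro i u ⟨ha, hi, h1, hm, hf⟩ hr
        obtain ⟨u₁, r₁, e₁, m₁, f₁⟩ := ihf ((d + 1) :: if vis then d :: ρ else ρ) [] (d + 4) u
          (by omega) (by
            have : ∀ r ∈ ρ, r < d + 4 := fun r hr => (hρ r hr).trans (by omega)
            cases vis <;> simpa using this) (by simp)
        have hρu : ρ.map u.reg = e := map_reg_congr hρ hf
        have hlist : ((d + 1) :: if vis then d :: ρ else ρ).map u.reg =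
            i :: if vis then accum F (a.eval M e []) i :: e else e := by
          cases vis <;> simp [hi, ha, hρu]
        rw [hlist, hm, hf 1 (by omega), ← hM] at e₁
        rw [hf 1 (by omega)] at r₁
        refine ⟨_, r₁.seq ((Run.of_exec (.plus _ _ _ _)).seq ((Run.of_exec (.plus _ _ _ _)).seq
          (Run.of_exec (.minus _ _ _ _)))), ⟨?_, ?_, ?_, ?_, ?_⟩, ?_⟩
        · simp [Store.setReg, e₁, f₁ d (by omega), ha, accum, F]
        · simp [Store.setReg, f₁ (d + 1) (by omega), f₁ (d + 3) (by omega), hi, h1]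
        · simp [Store.setReg, f₁ (d + 3) (by omega), h1]
        · simp [Store.setReg, m₁, hm]
        · intro r hr
          rw [← hf r hr, ← f₁ r (by omega)]
          simp [Store.setReg, show r ≠ d by omega, show r ≠ d + 1 by omega,
            show r ≠ d + 2 by omega]
        · simp [Store.setReg, f₁ (d + 2) (by omega), f₁ (d + 3) (by omega), h1])
      (s.reg 1) 0 (((s₁.setReg (d + 1) 0).setReg (d + 2) (s.reg 1)).setReg (d + 3) 1)
      (by
        refine ⟨?_, ?_, ?_, m₁, ?_⟩
        · simp [Store.setReg, e₁, accum]
        · simp [Store.setReg]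
        · simp [Store.setReg]
        · intro r hr
          rw [← f₁ r hr]
          simp [Store.setReg, show r ≠ d + 1 by omega, show r ≠ d + 2 by omega,
            show r ≠ d + 3 by omega])
      (by simp [Store.setReg])
    have hcopy : Run input (.copy (d + 2) 1) (s₁.setReg (d + 1) 0)
        ((s₁.setReg (d + 1) 0).setReg (d + 2) (s.reg 1)) 1 := by
      have h := Exec.copy (input := input) (s₁.setReg (d + 1) 0) (d + 2) 1
      have h1 : (s₁.setReg (d + 1) 0).reg 1 = s.reg 1 := by
        rw [← f₁ 1 (by omega)]
        exact Function.update_of_ne (by omega) _ _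
      rw [h1] at h
      exact .of_exec h
    refine ⟨s₂, r₁.seq ((Run.of_exec (.const _ _ _)).seq (hcopy.seq
      ((Run.of_exec (.const _ _ _)).seq r₂))), ?_, h₂.2.2.2.1, h₂.2.2.2.2⟩
    rw [h₂.1, Nat.zero_add]
    rfl

end Tm

/-! ## The program that fills a table -/

/-- Compute `s ^ 2 * 3 ^ (2 * w * 3 ^ k + 1)` in register `1`, for the input `_, w, k, s, …`. -/
def boundProg : Prog :=
  .seq (.const 5 1) <| .seq (.read 2 5) <| .seq (.const 4 2) <| .seq (.read 3 4) <|
  .seq (.const 4 3) <| .seq (.read 4 4) <|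
  .seq (.plus 6 2 2) <|
  .seq (.loop 3 (.seq (.plus 7 6 6) (.seq (.plus 6 7 6) (.minus 3 3 5)))) <|
  .seq (.copy 8 4) <|
  .seq (.loop 8 (.seq (.plus 1 1 4) (.minus 8 8 5))) <|
  .seq (.plus 6 6 5)
  (.loop 6 (.seq (.plus 7 1 1) (.seq (.plus 1 7 1) (.minus 6 6 5))))

/-- Without multiplication, `2 * w` is tripled `k` times to get the exponent, `m` is added `m` times
to get the square, and the square is then tripled. The time is linear in the numbers of iterations.
-/
theorem run_boundProg (input : List ℕ) {w k m : ℕ} (hw : input.getD 1 0 = w)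
    (hk : input.getD 2 0 = k) (hm : input.getD 3 0 = m) :
    ∃ s, Run input boundProg Store.init s (20 + 4 * k + 3 * m + 4 * (2 * w * 3 ^ k + 1)) ∧
      s.reg 1 = m ^ 2 * 3 ^ (2 * w * 3 ^ k + 1) ∧ s.reg 5 = 1 ∧ s.mem = fun _ => 0 := by
  -- The store after the seven straight-line instructions that read the parameters; `h₀` accounts
  -- for them.
  let s₀ : Store := ((((((Store.init.setReg 5 1).setReg 2 w).setReg 4 2).setReg 3 k).setReg 4
    3).setReg 4 m).setReg 6 (w + w)
  have h₀ : ∀ {P : Prog} {s T}, Run input P s₀ s T → Run input (.seq (.const 5 1) <|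
      .seq (.read 2 5) <| .seq (.const 4 2) <| .seq (.read 3 4) <| .seq (.const 4 3) <|
      .seq (.read 4 4) <| .seq (.plus 6 2 2) P) Store.init s (T + 7) := by
    intro P s T h
    have e₂ := Exec.read (input := input) (Store.init.setReg 5 1) 2 5
    have e₃ := Exec.read (input := input) (((Store.init.setReg 5 1).setReg 2 w).setReg 4 2) 3 4
    have e₄ := Exec.read (input := input)
      (((((Store.init.setReg 5 1).setReg 2 w).setReg 4 2).setReg 3 k).setReg 4 3) 4 4
    have e₅ := Exec.plus (input := input) ((((((Store.init.setReg 5 1).setReg 2 w).setReg 4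
      2).setReg 3 k).setReg 4 3).setReg 4 m) 6 2 2
    rw [show (Store.init.setReg 5 1).reg 5 = 1 from rfl, hw] at e₂
    rw [show (((Store.init.setReg 5 1).setReg 2 w).setReg 4 2).reg 4 = 2 from rfl, hk] at e₃
    rw [show (((((Store.init.setReg 5 1).setReg 2 w).setReg 4 2).setReg 3 k).setReg 4 3).reg 4 = 3
      from rfl, hm] at e₄
    exact ((Run.of_exec (.const _ _ _)).seq ((Run.of_exec e₂).seq ((Run.of_exec (.const _ _ _)).seq
      ((Run.of_exec e₃).seq ((Run.of_exec (.const _ _ _)).seq ((Run.of_exec e₄).seq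
      ((Run.of_exec e₅).seq h))))))).mono (by omega)
  obtain ⟨s₁, r₁, i₁⟩ := Run.countdown (input := input) (r := 3) (T := 3)
    (P := .seq (.plus 7 6 6) (.seq (.plus 6 7 6) (.minus 3 3 5)))
    (fun i s => s.reg 6 = 2 * w * 3 ^ i ∧ s.reg 5 = 1 ∧ s.reg 4 = m ∧ s.reg 1 = 0 ∧
      s.mem = fun _ => 0)
    (by
      rintro i s ⟨h6, h5, h4, h1, hm⟩ -
      refine ⟨_, (Run.of_exec (.plus _ _ _ _)).seq ((Run.of_exec (.plus _ _ _ _)).seq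
          (Run.of_exec (.minus _ _ _ _))), ⟨?_, ?_, ?_, ?_, hm⟩, ?_⟩
      · simp [Store.setReg, h6]; ring
      all_goals simp [Store.setReg, h5, h4, h1])
    k 0 s₀ (by simp [s₀, Store.setReg, Store.init, two_mul]) rfl
  obtain ⟨h6, h5, h4, h1, hm⟩ := i₁
  obtain ⟨s₂, r₂, i₂⟩ := Run.countdown (input := input) (r := 8) (T := 2)
    (P := .seq (.plus 1 1 4) (.minus 8 8 5))
    (fun i s => s.reg 6 = 2 * w * 3 ^ k ∧ s.reg 5 = 1 ∧ s.reg 4 = m ∧ s.reg 1 = i * m ∧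
      s.mem = fun _ => 0)
    (by
      rintro i s ⟨h6, h5, h4, h1, hm⟩ -
      refine ⟨_, (Run.of_exec (.plus _ _ _ _)).seq
          (Run.of_exec (.minus _ _ _ _)), ⟨?_, ?_, ?_, ?_, hm⟩, ?_⟩
      all_goals simp [Store.setReg, h5, h4, h1, h6, add_mul])
    m 0 (s₁.setReg 8 (s₁.reg 4))
    (by rw [Nat.zero_add] at h6; simp [Store.setReg, h6, h5, h4, h1, hm])
    (by simp [Store.setReg, h4])
  obtain ⟨h6, h5, h4, h1, hm⟩ := i₂
  obtain ⟨s₃, r₃, i₃⟩ := Run.countdown (input := input) (r := 6) (T := 3)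
    (P := .seq (.plus 7 1 1) (.seq (.plus 1 7 1) (.minus 6 6 5)))
    (fun i s => s.reg 1 = m ^ 2 * 3 ^ i ∧ s.reg 5 = 1 ∧ s.mem = fun _ => 0)
    (by
      rintro i s ⟨h1, h5, hm⟩ -
      refine ⟨_, (Run.of_exec (.plus _ _ _ _)).seq ((Run.of_exec (.plus _ _ _ _)).seq
          (Run.of_exec (.minus _ _ _ _))), ⟨?_, ?_, hm⟩, ?_⟩
      · simp [Store.setReg, h1]; ring
      all_goals simp [Store.setReg, h5])
    (2 * w * 3 ^ k + 1) 0 (s₂.setReg 6 (s₂.reg 6 + s₂.reg 5))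
    (by simp [Store.setReg, h5, h1, hm]; ring)
    (by simp [Store.setReg, h6, h5])
  rw [Nat.zero_add] at i₃
  exact ⟨s₃, (h₀ (r₁.seq ((Run.of_exec (.copy _ _ _)).seq (r₂.seq ((Run.of_exec
    (.plus _ _ _ _)).seq r₃))))).mono (by omega), i₃⟩

/-- Fill the memory by course-of-values recursion with `φ`, and answer with `ψ`. -/
def tableProg (φ ψ : Tm) : Prog :=
  .seq boundProg <| .seq (.const 2 0) <| .seq (.copy 3 1) <|
  .seq (.loop 3 (.seq (φ.compile [2] [] 10) (.seq (.store 2 10) (.seq (.plus 2 2 5)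
    (.minus 3 3 5))))) <|
  .seq (ψ.compile [] [] 10) (.copy 0 10)

/-- `T` is the final memory. When cell `q` is computed, all cells from `q` on still hold 0, which
explains the truncated memory in the recursion. The exponent `D` is chosen from the costs of the two
terms, before the input is given. -/
theorem run_tableProg (φ ψ : Tm) : ∃ D, ∀ (input : List ℕ) (w k m B : ℕ),
    input.getD 1 0 = w → input.getD 2 0 = k → input.getD 3 0 = m → 1 ≤ w → 1 ≤ m →
    B = m ^ 2 * 3 ^ (2 * w * 3 ^ k + 1) →
    ∃ (s : Store) (T : ℕ → ℕ), Run input (tableProg φ ψ) Store.init s ((B + 2) ^ D) ∧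
      (∀ q < B, T q = φ.eval ⟨fun i => input.getD i 0, fun x => if x < q then T x else 0, B⟩
        [q] []) ∧
      s.reg 0 = ψ.eval ⟨fun i => input.getD i 0, T, B⟩ [] [] := by
  obtain ⟨D₁, hD₁⟩ := φ.cost_le_pow
  obtain ⟨D₂, hD₂⟩ := ψ.cost_le_pow
  refine ⟨D₁ + D₂ + 8, ?_⟩
  intro input w k m B hw hk hm w1 m1 hB
  obtain ⟨s₁, r₁, h1, h5, hmem⟩ := run_boundProg input hw hk hm
  rw [← hB] at h1
  obtain ⟨s₂, r₂, i₂⟩ := Run.countdown (input := input) (r := 3) (T := φ.cost B + 3)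
    (P := .seq (φ.compile [2] [] 10) (.seq (.store 2 10) (.seq (.plus 2 2 5) (.minus 3 3 5))))
    (fun i s => s.reg 2 = i ∧ s.reg 5 = 1 ∧ s.reg 1 = B ∧ (∀ x, i ≤ x → s.mem x = 0) ∧
      ∀ q < i, s.mem q = φ.eval ⟨fun i => input.getD i 0,
        fun x => if x < q then s.mem x else 0, B⟩ [q] [])
    (by
      rintro i s ⟨h2, h5, h1, h0, hT⟩ -
      obtain ⟨s₁, r₁, e₁, m₁, f₁⟩ := φ.run_compile input [2] [] 10 s (by simp) (by simp) (by simp)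
      rw [h1] at r₁ e₁
      have hmem : (fun x => if x < i then s.mem x else 0) = s.mem := by
        funext x
        split_ifs with h
        · rfl
        · exact (h0 x (by omega)).symm
      refine ⟨_, (r₁.seq ((Run.of_exec (.store _ _ _)).seq ((Run.of_exec (.plus _ _ _ _)).seq
        (Run.of_exec (.minus _ _ _ _))))).mono (by omega), ⟨?_, ?_, ?_, ?_, ?_⟩, ?_⟩
      · simp [Store.setReg, Store.setMem, f₁, h2, h5]
      · simp [Store.setReg, Store.setMem, f₁, h5]
      · simp [Store.setReg, Store.setMem, f₁, h1]
      · intro x hx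
        simp [Store.setReg, Store.setMem, f₁, h2, m₁, show x ≠ i by omega, h0 x (by omega)]
      · intro q hq
        have hne : ∀ x < i, Function.update s.mem i (s₁.reg 10) x = s.mem x := fun x hx =>
          Function.update_of_ne hx.ne _ _
        have hpre : ∀ q ≤ i, (fun x => if x < q then Function.update s.mem i (s₁.reg 10) x else 0) =
            fun x => if x < q then s.mem x else 0 := by
          intro q hq
          funext x
          split_ifs with h
          · exact hne x (by omega)
          · rfl
        simp only [Store.setReg, Store.setMem, f₁ 2 (by omega), h2, m₁]
        rcases Nat.lt_succ_iff_lt_or_eq.1 hq with hq | rfl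
        · rw [hne q hq, hT q hq, hpre q hq.le]
        · rw [Function.update_self, hpre q le_rfl, e₁, hmem, List.map_singleton, h2, List.map_nil]
      · simp [Store.setReg, Store.setMem, f₁, h5])
    B 0 ((s₁.setReg 2 0).setReg 3 B)
    (by simp [Store.setReg, h5, h1, hmem]) (by simp [Store.setReg])
  obtain ⟨-, -, h1', -, hT⟩ := i₂
  rw [Nat.zero_add] at hT
  obtain ⟨s₃, r₃, e₃, -, -⟩ := ψ.run_compile input [] [] 10 s₂ (by simp) (by simp) (by simp)
  rw [h1'] at r₃ e₃
  have hcopy : Run input (.copy 3 1) (s₁.setReg 2 0) ((s₁.setReg 2 0).setReg 3 B) 1 := by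
    have h := Exec.copy (input := input) (s₁.setReg 2 0) 3 1
    rw [show (s₁.setReg 2 0).reg 1 = B from h1] at h
    exact .of_exec h
  refine ⟨_, s₂.mem, (r₁.seq ((Run.of_exec (.const _ _ _)).seq (hcopy.seq (r₂.seq (r₃.seq
    (Run.of_exec (.copy _ _ _))))))).mono ?_, hT, ?_⟩
  · have hk : k < 3 ^ k := Nat.lt_pow_self (by norm_num)
    have hk' : 3 ^ k ≤ w * 3 ^ k := Nat.le_mul_of_pos_left _ w1
    have hx : 2 * w * 3 ^ k + 1 < 3 ^ (2 * w * 3 ^ k + 1) := Nat.lt_pow_self (by norm_num)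
    have hB1 : 3 ^ (2 * w * 3 ^ k + 1) ≤ B := hB ▸ Nat.le_mul_of_pos_left _ (by positivity)
    have hB2 : m ≤ B := by
      rw [hB]
      calc m ≤ m ^ 2 := Nat.le_self_pow (by norm_num) m
        _ ≤ _ := Nat.le_mul_of_pos_right _ (by positivity)
    -- The loops that compute `B` are themselves short compared with `B`.
    have hB3 : k + m + (2 * w * 3 ^ k + 1) ≤ 3 * B := by
      have : 2 * w * 3 ^ k = 2 * (w * 3 ^ k) := by ring
      omega
    have e1 : (B + 2) ^ D₁ ≤ (B + 2) ^ (D₁ + D₂) := Nat.pow_le_pow_right (by omega) (by omega)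
    have e2 : (B + 2) ^ D₂ ≤ (B + 2) ^ (D₁ + D₂) := Nat.pow_le_pow_right (by omega) (by omega)
    have e3 : 1 ≤ (B + 2) ^ (D₁ + D₂) := Nat.one_le_pow _ _ (by omega)
    have h3 : B * (φ.cost B + 3 + 1) ≤ B * (5 * (B + 2) ^ (D₁ + D₂)) :=
      Nat.mul_le_mul_left _ (by have := hD₁ B; omega)
    have h4 : ψ.cost B ≤ (B + 2) ^ (D₁ + D₂) := (hD₂ B).trans e2
    have h5 : B ≤ B * (B + 2) ^ (D₁ + D₂) := Nat.le_mul_of_pos_right _ e3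
    rw [pow_add _ (D₁ + D₂) 8]
    set E := (B + 2) ^ (D₁ + D₂)
    have h6 : E * (B + 2) * 2 ^ 7 ≤ E * (B + 2) ^ 8 := by
      rw [pow_succ' (B + 2) 7, ← mul_assoc]
      exact Nat.mul_le_mul_left _ (Nat.pow_le_pow_left (by omega) 7)
    have h7 : E * (B + 2) * 2 ^ 7 = 128 * (B * E) + 256 * E := by ring
    have h8 : B * (5 * E) = 5 * (B * E) := by ring
    omega
  · simp [Store.setReg, e₃]

open Finset

/-! ## Digits -/

/-- The digit of `3 ^ i` in the ternary expansion of `x`. -/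
def digit (x i : ℕ) : ℕ := x / 3 ^ i % 3

/-- Horner's scheme: shift the number for the higher digits and append `f 0`. -/
theorem exists_digit_eq (m : ℕ) : ∀ f : ℕ → ℕ, (∀ i, f i < 3) →
    ∃ x < 3 ^ m, ∀ i < m, digit x i = f i := by
  induction m with
  | zero => exact fun f _ => ⟨0, by simp, by simp⟩
  | succ m ih =>
    intro f hf
    obtain ⟨x, hx, h⟩ := ih (fun i => f (i + 1)) fun i => hf _
    refine ⟨3 * x + f 0, by have := hf 0; rw [pow_succ]; omega, fun i hi => ?_⟩
    have h0 := hf 0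
    cases i with
    | zero => simp only [digit, pow_zero, Nat.div_one]; omega
    | succ i =>
      have h1 := h i (by omega)
      rw [digit] at h1 ⊢
      rw [pow_succ', ← Nat.div_div_eq_div_mul, show (3 * x + f 0) / 3 = x by omega, h1]

/-- Truncated counts determine the truncation of their sum, so a state never needs the true counts.
-/
theorem min_add_sum_min {ι : Type*} (s : Finset ι) (f : ι → ℕ) (x : ℕ) :
    min 2 (min 2 x + ∑ i ∈ s, min 2 (f i)) = min 2 (x + ∑ i ∈ s, f i) := by
  induction s using Finset.cons_induction generalizing x with
  | empty => simp
  | cons a s ha ih =>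
    have h : ∀ t : ℕ, min 2 (min 2 x + (min 2 (f a) + t)) = min 2 (min 2 (x + f a) + t) := by omega
    rw [sum_cons, sum_cons, ← add_assoc x, ← ih (x + f a), h]

/-! ## States of partial colourings

A state for labels in `{0, …, w - 1}` and `k` colours is a number with `(k + 3 ^ k) * w` ternary
digits. For each label, it has `k` digits that count the vertices of each colour up to `2`, and
`3 ^ k` digits that tell which colour vectors occur for the neighbourhoods of the vertices. A
labelling maps the vertices that are present to their label plus `1`, and all others to `0`. -/

/-- The digit for the label `a` and the colour `c + 1`. -/
def cnt (k x a c : ℕ) : ℕ := digit x ((k + 3 ^ k) * a + c)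

/-- The digit for the label `a` and the colour vector `τ`. -/
def typ (k x a τ : ℕ) : ℕ := digit x ((k + 3 ^ k) * a + (k + τ))

section States

variable {n : ℕ} (N : Fin n → Fin n → Prop)

open Classical in
/-- The number of vertices of label `a` and colour `c + 1`. -/
noncomputable def classCard (l C : Fin n → ℕ) (a c : ℕ) : ℕ :=
  #{v | l v = a + 1 ∧ C v = c + 1}

open Classical in
/-- The number of labelled neighbours of `v` of colour `c + 1`. -/
noncomputable def nbhdCard (l C : Fin n → ℕ) (v : Fin n) (c : ℕ) : ℕ :=
  #{u | l u ≠ 0 ∧ N v u ∧ C u = c + 1}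

/-- The digits of `τ` are the numbers of neighbours of `v` of each colour, counted up to `2`. -/
def HasType (k : ℕ) (l C : Fin n → ℕ) (v : Fin n) (τ : ℕ) : Prop :=
  ∀ c < k, digit τ c = min 2 (nbhdCard N l C v c)

/-- `x` is the state of the colouring `C` of the labelled vertices. -/
def IsState (w k : ℕ) (l C : Fin n → ℕ) (x : ℕ) : Prop :=
  ∀ a < w, (∀ c < k, cnt k x a c = min 2 (classCard l C a c)) ∧
    ∀ τ < 3 ^ k, (typ k x a τ ≠ 0 ↔ ∃ v, l v = a + 1 ∧ HasType N k l C v τ)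

/-- `x` is the state of a colouring of the labelled vertices with colours in `{lo, …, k}`. -/
def Realizable (lo w k : ℕ) (l : Fin n → ℕ) (x : ℕ) : Prop :=
  ∃ C : Fin n → ℕ, (∀ v, lo ≤ C v ∧ C v ≤ k) ∧ IsState N w k l C x

variable {N} {lo w k : ℕ} {l l₁ l₂ C C' : Fin n → ℕ}

theorem classCard_congr (h : ∀ v, l v ≠ 0 → C v = C' v) (a c : ℕ) :
    classCard l C a c = classCard l C' a c := by
  unfold classCard
  congr 1
  ext v
  simp only [mem_filter, mem_univ, true_and]
  exact and_congr_right fun hv => by rw [h v (by omega)]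

theorem nbhdCard_congr (h : ∀ v, l v ≠ 0 → C v = C' v) (v : Fin n) (c : ℕ) :
    nbhdCard N l C v c = nbhdCard N l C' v c := by
  unfold nbhdCard
  congr 1
  ext u
  simp only [mem_filter, mem_univ, true_and]
  exact and_congr_right fun hu => by rw [h u hu]

/-- Absent vertices enter no count. This is what permits gluing colourings of the two sides of a
union. -/
theorem IsState.congr (h : ∀ v, l v ≠ 0 → C v = C' v) {x : ℕ} (hx : IsState N w k l C x) :
    IsState N w k l C' x := by
  simpa only [IsState, HasType, classCard_congr h, nbhdCard_congr h] using hx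

theorem exists_hasType (N : Fin n → Fin n → Prop) (k : ℕ) (l C : Fin n → ℕ) (v : Fin n) :
    ∃ τ < 3 ^ k, HasType N k l C v τ :=
  exists_digit_eq k (fun c => min 2 (nbhdCard N l C v c)) fun _ => by omega

/-- Searching only the numbers below `3 ^ ((k + 3 ^ k) * w)` loses no colouring. A state is not
unique, as 1 and 2 both count as a set flag for a colour vector; the one built here uses 1. -/
theorem exists_isState (N : Fin n → Fin n → Prop) (w k : ℕ) (l C : Fin n → ℕ) :
    ∃ x < 3 ^ ((k + 3 ^ k) * w), IsState N w k l C x := by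
  classical
  set L := k + 3 ^ k with hL
  have hK : 0 < 3 ^ k := by positivity
  -- Position `i` lies in the block of label `i / L`; the first `k` places of a block are counters,
  -- the others are flags.
  obtain ⟨x, hx, h⟩ := exists_digit_eq (L * w) (fun i =>
    if i % L < k then min 2 (classCard l C (i / L) (i % L))
    else if ∃ v, l v = i / L + 1 ∧ HasType N k l C v (i % L - k) then 1 else 0)
    (fun i => by split_ifs <;> omega)
  refine ⟨x, hx, fun a ha => ?_⟩
  have hlt : ∀ r < L, L * a + r < L * w := fun r hr =>
    calc L * a + r < L * a + L := by omega
      _ = L * (a + 1) := by ring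
      _ ≤ L * w := Nat.mul_le_mul_left _ ha
  have hdiv : ∀ r < L, (L * a + r) / L = a := fun r hr => by
    rw [Nat.mul_add_div (by omega), Nat.div_eq_of_lt hr, add_zero]
  have hmod : ∀ r < L, (L * a + r) % L = r := fun r hr => by
    rw [Nat.mul_add_mod, Nat.mod_eq_of_lt hr]
  constructor
  · intro c hc
    have hcL : c < L := by omega
    rw [cnt, h _ (hlt c hcL), hdiv c hcL, hmod c hcL, if_pos hc]
  · intro τ hτ
    have hcL : k + τ < L := by omega
    rw [typ, h _ (hlt _ hcL), hdiv _ hcL, hmod _ hcL, if_neg (by omega), Nat.add_sub_cancel_left]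
    simp

/-! ### The states for the operations -/

/-- The states of the colourings of one vertex, with label `i` and colour `d`. -/
def VertexStep (cl w k i d x : ℕ) : Prop :=
  ∀ a < w, (∀ c < k, cnt k x a c = if a = i ∧ d = c + 1 then 1 else 0) ∧
    ∀ τ < 3 ^ k, (typ k x a τ ≠ 0 ↔
      a = i ∧ ∀ c < k, digit τ c = if cl = 1 ∧ d = c + 1 then 1 else 0)

/-- The only candidate for a neighbour is the vertex itself, so the colour vector is zero for open
neighbourhoods and has at most one entry 1 for closed ones. -/
theorem realizable_vertex {cl i : ℕ} {v : Fin n} (hv : N v v ↔ cl = 1)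
    (hl : ∀ u, l u = if u = v then i + 1 else 0) (x : ℕ) :
    Realizable N lo w k l x ↔ ∃ d ≤ k, lo ≤ d ∧ VertexStep cl w k i d x := by
  classical
  have hlv : ∀ u, l u ≠ 0 ↔ u = v := fun u => by rw [hl]; split_ifs with h <;> simp [h]
  have hla : ∀ u a, l u = a + 1 ↔ a = i ∧ u = v := fun u a => by
    rw [hl]; split_ifs with h <;> simp [h, eq_comm]
  have key : ∀ C : Fin n → ℕ, IsState N w k l C x ↔ VertexStep cl w k i (C v) x := by
    intro C
    have h1 : ∀ a c, min 2 (classCard l C a c) = if a = i ∧ C v = c + 1 then 1 else 0 := by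
      intro a c
      unfold classCard
      simp only [hla]
      split_ifs with h
      · rw [show (univ.filter fun u => (a = i ∧ u = v) ∧ C u = c + 1) = {v} by
          ext u; simp only [mem_filter, mem_univ, true_and, mem_singleton]
          exact ⟨fun hu => hu.1.2, fun hu => ⟨⟨h.1, hu⟩, hu ▸ h.2⟩⟩]
        simp
      · rw [filter_eq_empty_iff.2]
        · simp
        · rintro u - ⟨⟨ha, rfl⟩, hu⟩; exact h ⟨ha, hu⟩
    have h2 : ∀ c, min 2 (nbhdCard N l C v c) = if cl = 1 ∧ C v = c + 1 then 1 else 0 := by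
      intro c
      unfold nbhdCard
      simp only [hlv]
      split_ifs with h
      · rw [show (univ.filter fun u => u = v ∧ N v u ∧ C u = c + 1) = {v} by
          ext u; simp only [mem_filter, mem_univ, true_and, mem_singleton]
          exact ⟨fun hu => hu.1, fun hu => ⟨hu, hu ▸ hv.2 h.1, hu ▸ h.2⟩⟩]
        simp
      · rw [filter_eq_empty_iff.2]
        · simp
        · rintro u - ⟨rfl, ha, hu⟩; exact h ⟨hv.1 ha, hu⟩
    simp only [IsState, VertexStep, HasType, h1, hla, and_assoc, exists_and_left,
      exists_eq_left, h2]
  constructor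
  · rintro ⟨C, hC, hx⟩
    exact ⟨C v, (hC v).2, (hC v).1, (key C).1 hx⟩
  · rintro ⟨d, hd, hd', hx⟩
    exact ⟨fun _ => d, fun _ => ⟨hd', hd⟩, (key _).2 hx⟩

/-- The state `x` results from the state `y` by relabelling `i` to `j`. -/
def RelabelStep (w k i j y x : ℕ) : Prop :=
  ∀ a < w, (∀ c < k, cnt k x a c =
      min 2 (if a = i then 0 else cnt k y a c + if a = j then cnt k y i c else 0)) ∧
    ∀ τ < 3 ^ k, (typ k x a τ ≠ 0 ↔ a ≠ i ∧ (typ k y a τ ≠ 0 ∨ a = j ∧ typ k y i τ ≠ 0))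

/-- Neighbourhood counts depend on which vertices are present and not on their labels. Hence only
two blocks change: that of `j` absorbs that of `i`, which becomes empty. -/
theorem realizable_relabel {i j : ℕ} (hi : i < w) (hij : i ≠ j)
    (hl : ∀ u, l u = if l₁ u = i + 1 then j + 1 else l₁ u) (x : ℕ) :
    Realizable N lo w k l x ↔
      ∃ y < 3 ^ ((k + 3 ^ k) * w), Realizable N lo w k l₁ y ∧ RelabelStep w k i j y x := by
  classical
  have hl0 : ∀ u, l u ≠ 0 ↔ l₁ u ≠ 0 := fun u => by rw [hl]; split_ifs with h <;> simp [h]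
  have hla : ∀ u a, l u = a + 1 ↔ a ≠ i ∧ (l₁ u = a + 1 ∨ a = j ∧ l₁ u = i + 1) := by
    intro u a
    rw [hl]
    split_ifs with h
    · rw [h]; omega
    · constructor
      · intro h'; refine ⟨?_, Or.inl h'⟩; rintro rfl; exact h h'
      · rintro ⟨-, h' | h'⟩
        · exact h'
        · exact absurd h'.2 h
  have hnb : ∀ (C : Fin n → ℕ) v c, nbhdCard N l C v c = nbhdCard N l₁ C v c := by
    intro C v c
    unfold nbhdCard
    simp only [hl0]
  have hcl : ∀ (C : Fin n → ℕ) a c, classCard l C a c =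
      if a = i then 0 else classCard l₁ C a c + if a = j then classCard l₁ C i c else 0 := by
    intro C a c
    unfold classCard
    simp only [hla]
    split_ifs with h1 h2
    · simp [h1]
    · rw [← card_union_of_disjoint, ← filter_or]
      · congr 1
        ext u
        simp only [mem_filter, mem_univ, true_and]
        tauto
      · rw [disjoint_filter]
        rintro u - ⟨h, -⟩ ⟨h', -⟩
        omega
    · simp [h1, h2]
  -- For a fixed colouring, the step relation characterizes its new states by any one of its old
  -- states, so both directions follow with the same colouring.
  have key : ∀ (C : Fin n → ℕ) y, IsState N w k l₁ C y →
      (IsState N w k l C x ↔ RelabelStep w k i j y x) := by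
    intro C y hy
    refine forall₂_congr fun a ha => and_congr (forall₂_congr fun c hc => ?_)
      (forall₂_congr fun τ hτ => ?_)
    · rw [hcl, (hy a ha).1 c hc, (hy i hi).1 c hc]
      refine Eq.congr_right ?_
      split_ifs <;> omega
    · rw [(hy a ha).2 τ hτ, (hy i hi).2 τ hτ]
      refine iff_congr Iff.rfl ?_
      simp only [hla, HasType, hnb]
      constructor
      · rintro ⟨v, ⟨h1, h2 | h2⟩, h3⟩
        · exact ⟨h1, Or.inl ⟨v, h2, h3⟩⟩
        · exact ⟨h1, Or.inr ⟨h2.1, v, h2.2, h3⟩⟩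
      · rintro ⟨h1, ⟨v, h2, h3⟩ | ⟨h2, v, h3, h4⟩⟩
        · exact ⟨v, ⟨h1, Or.inl h2⟩, h3⟩
        · exact ⟨v, ⟨h1, Or.inr ⟨h2, h3⟩⟩, h4⟩
  constructor
  · rintro ⟨C, hC, hx⟩
    obtain ⟨y, hy, h⟩ := exists_isState N w k l₁ C
    exact ⟨y, hy, ⟨C, hC, h⟩, (key C y h).1 hx⟩
  · rintro ⟨y, -, ⟨C, hC, h⟩, hx⟩
    exact ⟨C, hC, (key C y h).2 hx⟩

/-- The colour vectors `τ` that arise, by the union with a graph in state `z`, for vertices of label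
`a` in a graph in state `y`, if the labels `b` with `S b = 1` are going to be joined to `a`, and
those with `S b = 0` are not. -/
def UnionType (w k : ℕ) (S : ℕ → ℕ) (y z a τ : ℕ) : Prop :=
  ∃ σ < 3 ^ k, typ k y a σ ≠ 0 ∧
    ∀ c < k, digit τ c = min 2 (digit σ c + ∑ b ∈ range w, S b * cnt k z b c)

/-- The state `x` results from the states `y` and `z` by a union, where the pairs of labels that are
going to be joined are given by `S`, and in the opposite order by `S'`. -/
def UnionStep (w k : ℕ) (S S' : ℕ → ℕ → ℕ) (y z x : ℕ) : Prop :=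
  ∀ a < w, (∀ c < k, cnt k x a c = min 2 (cnt k y a c + cnt k z a c)) ∧
    ∀ τ < 3 ^ k, (typ k x a τ ≠ 0 ↔
      UnionType w k (S a) y z a τ ∨ UnionType w k (S' a) z y a τ)

theorem classCard_add (hd : ∀ v, l₁ v = 0 ∨ l₂ v = 0) (hl : ∀ v, l v = l₁ v + l₂ v)
    (C : Fin n → ℕ) (a c : ℕ) : classCard l C a c = classCard l₁ C a c + classCard l₂ C a c := by
  classical
  unfold classCard
  rw [← card_union_of_disjoint, ← filter_or]
  · congr 1
    ext u
    simp only [mem_filter, mem_univ, true_and, hl]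
    have := hd u
    constructor
    · rintro ⟨h, h'⟩; rcases this with h0 | h0 <;> rw [h0] at h <;> omega
    · rintro (⟨h, h'⟩ | ⟨h, h'⟩) <;> omega
  · rw [disjoint_filter]
    rintro u - ⟨h, -⟩ ⟨h', -⟩
    have := hd u
    omega

/-- Seen from a vertex of label `a`, each label class of the other side consists entirely of
neighbours or entirely of non-neighbours, so the new neighbours are a disjoint union of classes. -/
theorem nbhdCard_add {a : ℕ} {S : ℕ → ℕ} (hd : ∀ v, l₁ v = 0 ∨ l₂ v = 0)
    (hl : ∀ v, l v = l₁ v + l₂ v) (hw : ∀ v, l₂ v ≤ w)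
    (hR : ∀ v u b, l₁ v = a + 1 → l₂ u = b + 1 → (N v u ↔ S b = 1))
    (hS : ∀ b, S b ≤ 1) {v : Fin n} (hv : l₁ v = a + 1)
    (C : Fin n → ℕ) (c : ℕ) :
    nbhdCard N l C v c = nbhdCard N l₁ C v c + ∑ b ∈ range w, S b * classCard l₂ C b c := by
  classical
  have hS : ∀ b, S b * classCard l₂ C b c = #{u | S b = 1 ∧ l₂ u = b + 1 ∧ C u = c + 1} := by
    intro b
    by_cases h : S b = 1
    · simp [h, classCard]
    · simp [show S b = 0 by have := hS b; omega]
  simp only [hS]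
  rw [← card_biUnion]
  · unfold nbhdCard
    rw [← card_union_of_disjoint]
    · congr 1
      ext u
      simp only [mem_filter, mem_univ, true_and, mem_union, mem_biUnion, mem_range]
      have hdu := hd u
      have hlu := hl u
      constructor
      · rintro ⟨h, h', h''⟩
        by_cases hu : l₁ u = 0
        -- Labellings store the label plus 1.
        · refine Or.inr ⟨l₂ u - 1, ?_, ?_, ?_, h''⟩
          · have := hw u; omega
          · exact (hR v u _ hv (by omega)).1 h'
          · omega
        · exact Or.inl ⟨hu, h', h''⟩
      · rintro (⟨h, h', h''⟩ | ⟨b, -, h, h', h''⟩)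
        · exact ⟨by omega, h', h''⟩
        · exact ⟨by omega, (hR v u b hv h').2 h, h''⟩
    · rw [disjoint_left]
      intro u hu hu'
      simp only [mem_filter, mem_univ, true_and, mem_biUnion, mem_range] at hu hu'
      obtain ⟨b, -, -, h, -⟩ := hu'
      have := hd u
      omega
  · intro b _ b' _ hb
    rw [Function.onFun, disjoint_filter]
    rintro u - ⟨-, h, -⟩ ⟨-, h', -⟩
    omega

/-- All vertices of label `a` receive the same contribution from the other side, so the old colour
vector determines the new one and the set of occurring vectors can be updated without knowing the
vertices. -/
theorem unionType_iff {a : ℕ} (ha : a < w) {S : ℕ → ℕ} {y z : ℕ}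
    (hd : ∀ v, l₁ v = 0 ∨ l₂ v = 0) (hl : ∀ v, l v = l₁ v + l₂ v) (hw : ∀ v, l₂ v ≤ w)
    (hR : ∀ v u b, l₁ v = a + 1 → l₂ u = b + 1 → (N v u ↔ S b = 1)) (hS : ∀ b, S b ≤ 1)
    (hy : IsState N w k l₁ C y) (hz : IsState N w k l₂ C z) (τ : ℕ) :
    UnionType w k S y z a τ ↔ ∃ v, l₁ v = a + 1 ∧ HasType N k l C v τ := by
  classical
  have key : ∀ v, l₁ v = a + 1 → ∀ σ,
      HasType N k l₁ C v σ → ((∀ c < k, digit τ c =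
        min 2 (digit σ c + ∑ b ∈ range w, S b * cnt k z b c)) ↔ HasType N k l C v τ) := by
    intro v hv σ hσ
    refine forall₂_congr fun c hc => Eq.congr_right ?_
    rw [hσ c hc, nbhdCard_add hd hl hw hR hS hv,
      ← min_add_sum_min _ fun b => S b * classCard l₂ C b c]
    congr 2
    refine sum_congr rfl fun b hb => ?_
    rw [(hz b (mem_range.1 hb)).1 c hc]
    rcases Nat.le_one_iff_eq_zero_or_eq_one.1 (hS b) with h | h <;> simp [h]
  constructor
  · rintro ⟨σ, hσ, h, hτ⟩
    obtain ⟨v, hv, hv'⟩ := ((hy a ha).2 σ hσ).1 h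
    exact ⟨v, hv, (key v hv σ hv').1 hτ⟩
  · rintro ⟨v, hv, h⟩
    obtain ⟨σ, hσ, hv'⟩ := exists_hasType N k l₁ C v
    exact ⟨σ, hσ, ((hy a ha).2 σ hσ).2 ⟨v, hv, hv'⟩, (key v hv σ hv').2 h⟩

/-- The colourings of the two sides can be chosen independently, and the combined state depends only
on their states. Both orders of the sides are needed because the vertices of each gain neighbours in
the other. -/
theorem realizable_union {S S' : ℕ → ℕ → ℕ} (hd : ∀ v, l₁ v = 0 ∨ l₂ v = 0)
    (hl : ∀ v, l v = l₁ v + l₂ v) (hw₁ : ∀ v, l₁ v ≤ w) (hw₂ : ∀ v, l₂ v ≤ w)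
    (hR : ∀ u v a b, l₁ u = a + 1 → l₂ v = b + 1 → (N u v ↔ S a b = 1))
    (hS : ∀ a b, S a b ≤ 1)
    (hR' : ∀ u v a b, l₂ u = a + 1 → l₁ v = b + 1 → (N u v ↔ S' a b = 1))
    (hS' : ∀ a b, S' a b ≤ 1) (x : ℕ) :
    Realizable N lo w k l x ↔ ∃ y < 3 ^ ((k + 3 ^ k) * w), ∃ z < 3 ^ ((k + 3 ^ k) * w),
      Realizable N lo w k l₁ y ∧ Realizable N lo w k l₂ z ∧ UnionStep w k S S' y z x := by
  have key : ∀ (C : Fin n → ℕ) y z, IsState N w k l₁ C y → IsState N w k l₂ C z →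
      (IsState N w k l C x ↔ UnionStep w k S S' y z x) := by
    intro C y z hy hz
    refine forall₂_congr fun a ha => and_congr (forall₂_congr fun c hc => ?_)
      (forall₂_congr fun τ hτ => iff_congr Iff.rfl ?_)
    · rw [classCard_add hd hl, (hy a ha).1 c hc, (hz a ha).1 c hc]
      refine Eq.congr_right ?_
      omega
    · rw [unionType_iff ha hd hl hw₂ (fun v u b hv hu => hR v u a b hv hu) (hS a) hy hz,
        unionType_iff ha (fun v => (hd v).symm) (fun v => (hl v).trans (add_comm _ _)) hw₁
          (fun v u b hv hu => hR' v u a b hv hu) (hS' a) hz hy, ← exists_or]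
      refine exists_congr fun v => ?_
      rw [← or_and_right, hl]
      refine and_congr_left fun _ => ?_
      have := hd v
      omega
  constructor
  · rintro ⟨C, hC, hx⟩
    obtain ⟨y, hy, hy'⟩ := exists_isState N w k l₁ C
    obtain ⟨z, hz, hz'⟩ := exists_isState N w k l₂ C
    exact ⟨y, hy, z, hz, ⟨C, hC, hy'⟩, ⟨C, hC, hz'⟩, (key C y z hy' hz').1 hx⟩
  · rintro ⟨y, -, z, -, ⟨C₁, hC₁, hy⟩, ⟨C₂, hC₂, hz⟩, hx⟩
    -- Glue the two colourings. Vertices on neither side take a colour from `C₂`, which keeps the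
    -- range condition valid everywhere.
    let C : Fin n → ℕ := fun v => if l₁ v = 0 then C₂ v else C₁ v
    have e₁ : ∀ v, l₁ v ≠ 0 → C₁ v = C v := fun v hv => (if_neg hv).symm
    have e₂ : ∀ v, l₂ v ≠ 0 → C₂ v = C v := fun v hv => (if_pos ((hd v).resolve_right hv)).symm
    refine ⟨C, fun v => ?_, (key C y z (hy.congr e₁) (hz.congr e₂)).2 hx⟩
    dsimp only [C]
    split_ifs
    exacts [hC₂ v, hC₁ v]

/-- Every colour vector in the state has a digit `1`. -/
def GoodState (w k x : ℕ) : Prop :=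
  ∀ a < w, ∀ τ < 3 ^ k, typ k x a τ ≠ 0 → ∃ c < k, digit τ c = 1

/-- Once every vertex is present, the counts are over full neighbourhoods, and a count truncated at
2 equals 1 exactly when the count does. -/
theorem exists_goodState_iff (h0 : ∀ v, l v ≠ 0) (hw : ∀ v, l v ≤ w) :
    (∃ x < 3 ^ ((k + 3 ^ k) * w), Realizable N lo w k l x ∧ GoodState w k x) ↔
      ∃ C : Fin n → ℕ, (∀ v, lo ≤ C v ∧ C v ≤ k) ∧
        ∀ v, ∃ c < k, {u | N v u ∧ C u = c + 1}.ncard = 1 := by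
  classical
  have hcard : ∀ (C : Fin n → ℕ) v c, nbhdCard N l C v c = {u | N v u ∧ C u = c + 1}.ncard := by
    intro C v c
    rw [nbhdCard, Set.ncard_eq_toFinset_card']
    congr 1
    ext u
    simp [h0]
  have key : ∀ (C : Fin n → ℕ) x, IsState N w k l C x → (GoodState w k x ↔
      ∀ v, ∃ c < k, {u | N v u ∧ C u = c + 1}.ncard = 1) := by
    intro C x hx
    constructor
    · intro h v
      obtain ⟨τ, hτ, hv⟩ := exists_hasType N k l C v
      have hv0 := h0 v
      have hvw := hw v
      obtain ⟨c, hc, h1⟩ := h (l v - 1) (by omega) τ hτ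
        (((hx (l v - 1) (by omega)).2 τ hτ).2 ⟨v, by omega, hv⟩)
      rw [hv c hc, hcard] at h1
      exact ⟨c, hc, by omega⟩
    · intro h a ha τ hτ hne
      obtain ⟨v, -, hv⟩ := ((hx a ha).2 τ hτ).1 hne
      obtain ⟨c, hc, h1⟩ := h v
      exact ⟨c, hc, by rw [hv c hc, hcard, h1]; rfl⟩
  constructor
  · rintro ⟨x, -, ⟨C, hC, hx⟩, h⟩
    exact ⟨C, hC, (key C x hx).1 h⟩
  · rintro ⟨C, hC, h⟩
    obtain ⟨x, hx, hx'⟩ := exists_isState N w k l C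
    exact ⟨x, hx, ⟨C, hC, hx'⟩, (key C x hx').2 h⟩

end States

/-! ## Expressions and their encodings -/

namespace CWExpr

variable {V : Type*} {n w : ℕ}

theorem size_pos (Φ : CWExpr V w) : 0 < Φ.size := by cases Φ <;> simp [size]

theorem pos_of_expr (Φ : CWExpr V w) : 0 < w := by
  induction Φ with
  | vertex v i => exact i.pos
  | union Φ Ψ ih => exact ih
  | relabel i => exact i.pos
  | join i => exact i.pos

variable [DecidableEq V]

/-- The label plus `1`, or `0` if there is none. -/
def lab (Φ : CWExpr V w) (v : V) : ℕ := (Φ.label v).elim 0 fun a => a + 1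

theorem lab_eq_zero {Φ : CWExpr V w} {v : V} : Φ.lab v = 0 ↔ Φ.label v = none := by
  unfold lab; cases Φ.label v <;> simp

theorem lab_eq_succ {Φ : CWExpr V w} {v : V} {a : Fin w} :
    Φ.lab v = a + 1 ↔ Φ.label v = some a := by
  unfold lab; cases Φ.label v <;> simp [Fin.ext_iff]

theorem lab_le (Φ : CWExpr V w) (v : V) : Φ.lab v ≤ w := by
  unfold lab; cases h : Φ.label v with
  | none => simp
  | some a => exact a.2

theorem lab_vertex (v u : V) (i : Fin w) :
    (vertex v i).lab u = if u = v then (i : ℕ) + 1 else 0 := by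
  unfold lab label; split_ifs <;> rfl

theorem lab_relabel (i j : Fin w) (hij : i ≠ j) (Φ : CWExpr V w) (u : V) :
    (relabel i j hij Φ).lab u = if Φ.lab u = i + 1 then (j : ℕ) + 1 else Φ.lab u := by
  rw [lab, label]
  simp only [lab_eq_succ]
  unfold lab
  cases h : Φ.label u with
  | none => simp
  | some a => simp only [Option.map_some, Option.elim_some, Option.some.injEq]; split_ifs <;> rfl

theorem lab_union {Φ Ψ : CWExpr V w} (hd : ∀ u, Φ.label u = none ∨ Ψ.label u = none) (u : V) :
    (union Φ Ψ).lab u = Φ.lab u + Ψ.lab u := by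
  unfold lab
  rw [label]
  rcases hd u with h | h <;> rw [h] <;> simp

theorem label_ne_none_of_adj (Φ : CWExpr V w) {u v : V} (h : Φ.graph.Adj u v) :
    Φ.label u ≠ none := by
  induction Φ generalizing u v with
  | vertex => exact absurd h id
  | union Φ Ψ ih ih' =>
    rw [label, ne_eq, Option.or_eq_none_iff]
    rintro ⟨h1, h2⟩
    rcases h with h | h
    exacts [ih h h1, ih' h h2]
  | relabel i j _ Φ ih => rw [label, ne_eq, Option.map_eq_none_iff]; exact ih h
  | join i j _ Φ ih =>
    rw [label]
    rcases h with h | ⟨-, ⟨h, -⟩ | ⟨-, h⟩⟩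
    · exact ih h
    all_goals simp [h]

/-- All unions in the expression are disjoint, and whether `G` has an edge between two vertices
from different sides of a union depends only on their labels. -/
def Uniform (G : SimpleGraph V) : CWExpr V w → Prop
  | vertex _ _ => True
  | union Φ Ψ => Φ.Uniform G ∧ Ψ.Uniform G ∧ (∀ u, Φ.label u = none ∨ Ψ.label u = none) ∧
      ∃ R : Fin w → Fin w → Prop, ∀ u v a b,
        Φ.label u = some a → Ψ.label v = some b → (G.Adj u v ↔ R a b)
  | relabel _ _ _ Φ => Φ.Uniform G
  | join _ _ _ Φ => Φ.Uniform G

/-- `R` collects the pairs of labels that the operations above `Φ` will join. The induction descends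
from the root, pulling `R` back along relabellings and enlarging it at joins; across a union neither
side has an edge, so `R` alone decides. -/
theorem uniform_of_adj_iff (G : SimpleGraph V) (Φ : CWExpr V w) (hΦ : Φ.Valid)
    (R : Fin w → Fin w → Prop) (hR : ∀ u v a b, Φ.label u = some a → Φ.label v = some b →
      (G.Adj u v ↔ Φ.graph.Adj u v ∨ R a b)) : Φ.Uniform G := by
  induction Φ generalizing R with
  | vertex => trivial
  | union Φ Ψ ih ih' =>
    obtain ⟨h₁, h₂, hd⟩ := hΦ
    have l₁ : ∀ u a, Φ.label u = some a → (union Φ Ψ).label u = some a := fun u a h => by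
      simp [label, h]
    have l₂ : ∀ u a, Ψ.label u = some a → (union Φ Ψ).label u = some a := fun u a h => by
      simp [label, h, (hd u).resolve_right (by simp [h])]
    have n₁ : ∀ u v a, Ψ.label u = some a → ¬ Φ.graph.Adj u v := fun u v a h h' =>
      Φ.label_ne_none_of_adj h' ((hd u).resolve_right (by simp [h]))
    have n₂ : ∀ u v a, Φ.label u = some a → ¬ Ψ.graph.Adj u v := fun u v a h h' =>
      Ψ.label_ne_none_of_adj h' ((hd u).resolve_left (by simp [h]))
    refine ⟨ih h₁ R fun u v a b hu hv => ?_, ih' h₂ R fun u v a b hu hv => ?_, hd, R,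
      fun u v a b hu hv => ?_⟩
    · rw [hR u v a b (l₁ u a hu) (l₁ v b hv), graph, SimpleGraph.sup_adj, or_iff_left (n₂ u v a hu)]
    · rw [hR u v a b (l₂ u a hu) (l₂ v b hv), graph, SimpleGraph.sup_adj,
        or_iff_right (n₁ u v a hu)]
    · rw [hR u v a b (l₁ u a hu) (l₂ v b hv), graph, SimpleGraph.sup_adj,
        or_iff_left (n₂ u v a hu), or_iff_right]
      exact fun h => n₁ v u b hv h.symm
  | relabel i j hij Φ ih =>
    refine ih hΦ (fun a b => R (if a = i then j else a) (if b = i then j else b))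
      fun u v a b hu hv => ?_
    exact hR u v _ _ (by simp [label, hu]) (by simp [label, hv])
  | join i j hij Φ ih =>
    refine ih hΦ (fun a b => (a = i ∧ b = j ∨ b = i ∧ a = j) ∨ R a b) fun u v a b hu hv => ?_
    rw [hR u v a b hu hv, graph, SimpleGraph.sup_adj, SimpleGraph.fromRel_adj, hu, hv, or_assoc]
    simp only [Option.some.injEq]
    refine or_congr_right (or_congr_left ⟨fun h => h.2, fun h => ⟨?_, h⟩⟩)
    -- `fromRel` excludes loops, but none could arise: a vertex has one label, and `i ≠ j`.
    rintro rfl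
    have hab : a = b := by rw [hu] at hv; exact Option.some.inj hv
    subst hab
    rcases h with ⟨rfl, h⟩ | ⟨rfl, h⟩ <;> exact hij h

theorem Defines.uniform {Φ : CWExpr V w} {G : SimpleGraph V} (h : Φ.Defines G) : Φ.Uniform G :=
  Φ.uniform_of_adj_iff G h.1 (fun _ _ => False) fun u v a b _ _ => by rw [h.2.2, or_false]

/-- Every vertex has to be introduced by an operation. This gives `n ≤ |Φ|`, so that the `n` labels
stored in a row fit into a bound in terms of `|Φ|`. -/
theorem card_label_le_size [Fintype V] (Φ : CWExpr V w) :
    (Finset.univ.filter fun v => Φ.label v ≠ none).card ≤ Φ.size := by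
  induction Φ with
  | vertex v i =>
    refine (Finset.card_le_card (t := {v}) fun u hu => ?_).trans (by simp [size])
    by_contra h
    simp_all [label]
  | union Φ Ψ ih ih' =>
    refine (Finset.card_le_card (t := (Finset.univ.filter fun v => Φ.label v ≠ none) ∪
      Finset.univ.filter fun v => Ψ.label v ≠ none) fun u hu => ?_).trans
      ((Finset.card_union_le _ _).trans (by simp only [size]; omega))
    simp only [Finset.mem_filter, Finset.mem_univ, true_and, Finset.mem_union, label, ne_eq,
      Option.or_eq_none_iff] at hu ⊢
    tauto
  | relabel i j hij Φ ih => simpa [label, size] using ih.trans (Nat.le_succ _)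
  | join i j hij Φ ih => exact ih.trans (Nat.le_succ _)

theorem Defines.card_le_size {Φ : CWExpr (Fin n) w} {G : SimpleGraph (Fin n)}
    (h : Φ.Defines G) : n ≤ Φ.size := by
  have := Φ.card_label_le_size
  rwa [Finset.filter_true_of_mem fun v _ => h.2.1 v, Finset.card_univ, Fintype.card_fin] at this

theorem length_encode (Φ : CWExpr (Fin n) w) : Φ.encode.length = 3 * Φ.size := by
  induction Φ with
  | vertex => rfl
  | union Φ Ψ ih ih' => simp only [encode, List.length_append, ih, ih', size]; simp; ring
  | relabel _ _ _ Φ ih => simp only [encode, List.length_append, ih, size]; simp; ring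
  | join _ _ _ Φ ih => simp only [encode, List.length_append, ih, size]; simp; ring

end CWExpr

theorem getD_flatMap {α : Type*} {m : ℕ} (f : α → List ℕ) (hf : ∀ a, (f a).length = m) (d : α) :
    ∀ (l : List α) (i j : ℕ), i < l.length → j < m →
      (l.flatMap f).getD (m * i + j) 0 = (f (l.getD i d)).getD j 0 := by
  intro l
  induction l with
  | nil => intro i j hi; simp at hi
  | cons a l ih =>
    intro i j hi hj
    rw [List.flatMap_cons]
    cases i with
    | zero =>
      rw [List.getD_append _ _ _ _ (by rw [hf]; omega)]; simp
    | succ i =>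
      rw [List.getD_append_right _ _ _ _ (by rw [hf, mul_add]; omega), hf,
        show m * (i + 1) + j - m = m * i + j by rw [mul_add]; omega,
        ih i j (by simpa using hi) hj, List.getD_cons_succ]

theorem getD_encodeGraph {n : ℕ} (G : SimpleGraph (Fin n)) (u v : Fin n) :
    (encodeGraph G).getD (n * u + v) 0 ≠ 0 ↔ G.Adj u v := by
  classical
  rw [encodeGraph, getD_flatMap _ (by simp) u _ _ _ (by simp) v.2]
  simp

section Instance

variable {n w : ℕ} (G : SimpleGraph (Fin n)) (Φ : CWExpr (Fin n) w) (k : ℕ)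

theorem encodeInstance_params : (encodeInstance G Φ k).getD 0 0 = n ∧
    (encodeInstance G Φ k).getD 1 0 = w ∧ (encodeInstance G Φ k).getD 2 0 = k ∧
    (encodeInstance G Φ k).getD 3 0 = Φ.size := by
  simp [encodeInstance]

theorem encodeInstance_expr {i : ℕ} (hi : i < 3 * Φ.size) :
    (encodeInstance G Φ k).getD (4 + i) 0 = Φ.encode.getD i 0 := by
  rw [encodeInstance, List.append_assoc, List.getD_append_right _ _ _ _ (by simp),
    List.getD_append _ _ _ _ (by simpa [Φ.length_encode] using hi)]
  simp

theorem encodeInstance_graph (u v : Fin n) :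
    (encodeInstance G Φ k).getD (4 + (3 * Φ.size + (n * u + v))) 0 ≠ 0 ↔ G.Adj u v := by
  have hlen : ([n, w, k, Φ.size] ++ Φ.encode).length = 4 + 3 * Φ.size := by
    simp [Φ.length_encode]; omega
  rw [encodeInstance, List.getD_append_right _ _ _ _ (by omega), ← getD_encodeGraph, hlen,
    ← add_assoc, Nat.add_sub_cancel_left]

end Instance


namespace Tm

/-! ## Terms for arithmetic and logic -/

def neg (a : Tm) : Tm := ite a (const 0) (const 1)
def conj (a b : Tm) : Tm := ite a b (const 0)
def disj (a b : Tm) : Tm := ite a (const 1) b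
def iff (a b : Tm) : Tm := ite a b (neg b)
-- Any nonzero value means truth, so truncated subtraction already is a comparison.
def lt (a b : Tm) : Tm := sub b a
def le (a b : Tm) : Tm := neg (sub a b)
def eq (a b : Tm) : Tm := conj (le a b) (le b a)
/-- The sum of the values of `f` for all numbers less than `n`; as a formula, it says that there is
a number less than `n` with `f`. -/
def ex (n f : Tm) : Tm := loop false (const 0) (conj (lt (var 0) n) f)
def all (n f : Tm) : Tm := neg (ex n (neg f))
def call₁ (t a : Tm) : Tm := app (fn t) a
-- The outer `app` pushes its argument first, so `t` sees the arguments in the order written.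
def call₂ (t a b : Tm) : Tm := app (app (fn t) a) b
def call₃ (t a b c : Tm) : Tm := app (app (app (fn t) a) b) c
def call₄ (t a b c d : Tm) : Tm := app (app (app (app (fn t) a) b) c) d
def call₅ (t a b c d e : Tm) : Tm := app (app (app (app (app (fn t) a) b) c) d) e
def call₆ (t a b c d e f : Tm) : Tm := app (app (app (app (app (app (fn t) a) b) c) d) e) f

/-- The formula `t` holds for the values `e` of its variables. -/
def Holds (M : Mach) (t : Tm) (e : List ℕ) : Prop := t.eval M e [] ≠ 0

section Logic

variable {M : Mach} {e : List ℕ} {a b c d f g t : Tm}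

theorem holds_const {i : ℕ} : Holds M (const i) e ↔ i ≠ 0 := Iff.rfl

theorem eval_neg : (neg a).eval M e [] = if a.eval M e [] = 0 then 1 else 0 := rfl

theorem eval_add : (add a b).eval M e [] = a.eval M e [] + b.eval M e [] := rfl

theorem eval_sub : (sub a b).eval M e [] = a.eval M e [] - b.eval M e [] := rfl

theorem eval_const {i : ℕ} : (const i).eval M e [] = i := rfl

theorem holds_neg : Holds M (neg a) e ↔ ¬ Holds M a e := by
  unfold Holds; rw [eval_neg]; split_ifs with h <;> simp [h]

open Classical in
theorem eval_ite : (ite c a b).eval M e [] =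
    if Holds M c e then a.eval M e [] else b.eval M e [] := by
  unfold Holds
  rw [eval]
  by_cases h : c.eval M e [] = 0 <;> simp [h]

theorem eval_ite_pos (h : Holds M c e) : (ite c a b).eval M e [] = a.eval M e [] := by
  rw [eval_ite, if_pos h]

theorem eval_ite_neg (h : ¬ Holds M c e) : (ite c a b).eval M e [] = b.eval M e [] := by
  rw [eval_ite, if_neg h]

theorem holds_ite_pos (h : Holds M c e) : Holds M (ite c a b) e ↔ Holds M a e := by
  rw [Holds, eval_ite_pos h]; rfl

theorem holds_ite_neg (h : ¬ Holds M c e) : Holds M (ite c a b) e ↔ Holds M b e := by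
  rw [Holds, eval_ite_neg h]; rfl

theorem eval_conj : (conj a b).eval M e [] = if a.eval M e [] = 0 then 0 else b.eval M e [] := rfl

theorem holds_ite : Holds M (ite c a b) e ↔
    Holds M c e ∧ Holds M a e ∨ ¬ Holds M c e ∧ Holds M b e := by
  rw [Holds, eval_ite]; unfold Holds; split_ifs with h <;> simp [h]

theorem holds_conj : Holds M (conj a b) e ↔ Holds M a e ∧ Holds M b e := by
  rw [conj, holds_ite, holds_const]; simp

theorem holds_disj : Holds M (disj a b) e ↔ Holds M a e ∨ Holds M b e := by
  rw [disj, holds_ite, holds_const]; tauto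

theorem holds_iff : Holds M (iff a b) e ↔ (Holds M a e ↔ Holds M b e) := by
  rw [iff, holds_ite, holds_neg]; tauto

theorem holds_lt : Holds M (lt a b) e ↔ a.eval M e [] < b.eval M e [] := by
  rw [lt, Holds, eval_sub]; omega

theorem holds_le : Holds M (le a b) e ↔ a.eval M e [] ≤ b.eval M e [] := by
  rw [le, holds_neg, Holds, eval_sub]; omega

theorem holds_eq : Holds M (eq a b) e ↔ a.eval M e [] = b.eval M e [] := by
  rw [eq, holds_conj, holds_le, holds_le]; omega

theorem accum_const (h : ℕ → ℕ) (x n : ℕ) :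
    accum (fun i _ => h i) x n = x + ∑ i ∈ Finset.range n, h i := by
  induction n with
  | zero => rfl
  | succ n ih => rw [accum, ih, Finset.sum_range_succ, add_assoc]

/-- The loop always runs `M.bd` times, and iterations from `m` on add 0. The limit `t` is evaluated
inside the loop, under an extended list of variables, hence the quantifier in `hn`. -/
theorem eval_ex {m : ℕ} (hn : ∀ e, t.eval M e [] = m) (hm : m ≤ M.bd) :
    (ex t f).eval M e [] = ∑ i ∈ Finset.range m, f.eval M (i :: e) [] := by
  have h : (ex t f).eval M e [] = accum (fun i _ => if t.eval M (i :: e) [] - i = 0 then 0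
    else f.eval M (i :: e) []) 0 M.bd := rfl
  rw [h, accum_const, zero_add]
  simp only [hn]
  refine (Finset.sum_subset_zero_on_sdiff (Finset.range_mono hm) (fun i hi => ?_)
    fun i hi => ?_).symm
  · simp only [Finset.mem_sdiff, Finset.mem_range] at hi
    rw [if_pos (by omega)]
  · rw [Finset.mem_range] at hi
    rw [if_neg (by omega)]

theorem holds_ex {m : ℕ} (hn : ∀ e, t.eval M e [] = m) (hm : m ≤ M.bd) :
    Holds M (ex t f) e ↔ ∃ i < m, Holds M f (i :: e) := by
  unfold Holds
  rw [eval_ex hn hm, ne_eq, Finset.sum_eq_zero_iff]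
  simp

theorem holds_all {m : ℕ} (hn : ∀ e, t.eval M e [] = m) (hm : m ≤ M.bd) :
    Holds M (all t f) e ↔ ∀ i < m, Holds M f (i :: e) := by
  rw [all, holds_neg, holds_ex hn hm]
  simp only [holds_neg]
  push Not
  rfl

theorem eval_call₁ : (call₁ t a).eval M e [] = t.eval M [a.eval M e []] [] := rfl

theorem eval_call₂ : (call₂ t a b).eval M e [] = t.eval M [a.eval M e [], b.eval M e []] [] := rfl

theorem eval_call₃ : (call₃ t a b c).eval M e [] =
    t.eval M [a.eval M e [], b.eval M e [], c.eval M e []] [] := rfl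

theorem holds_call₁ : Holds M (call₁ t a) e ↔ Holds M t [a.eval M e []] := Iff.rfl

theorem holds_call₃ : Holds M (call₃ t a b c) e ↔
    Holds M t [a.eval M e [], b.eval M e [], c.eval M e []] := Iff.rfl

theorem holds_call₄ : Holds M (call₄ t a b c d) e ↔
    Holds M t [a.eval M e [], b.eval M e [], c.eval M e [], d.eval M e []] := Iff.rfl

theorem holds_call₅ : Holds M (call₅ t a b c d f) e ↔
    Holds M t [a.eval M e [], b.eval M e [], c.eval M e [], d.eval M e [], f.eval M e []] := Iff.rfl

theorem holds_call₆ : Holds M (call₆ t a b c d f g) e ↔ Holds M t [a.eval M e [], b.eval M e [],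
    c.eval M e [], d.eval M e [], f.eval M e [], g.eval M e []] := Iff.rfl

theorem eval_var_zero {x : ℕ} : (var 0).eval M (x :: e) [] = x := rfl

end Logic

def mulBody : Tm := loop false (const 0) (ite (lt (var 0) (var 2)) (var 1) (const 0))
def mul (a b : Tm) : Tm := call₂ mulBody a b
-- The quotient is the number of `i` with `b * (i + 1) ≤ a`.
def divBody : Tm :=
  loop false (const 0) (le (mul (var 2) (add (var 0) (const 1))) (var 1))
def div (a b : Tm) : Tm := call₂ divBody a b
-- Adding `y + y` to `y` triples it; this is the only loop whose body reads the accumulator.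
def powBody : Tm := loop true (const 1) (ite (lt (var 0) (var 2)) (add (var 1) (var 1)) (const 0))
/-- The power `3 ^ a`. -/
def pow (a : Tm) : Tm := call₁ powBody a
def digBody : Tm :=
  sub (div (var 0) (pow (var 1))) (mul (const 3) (div (div (var 0) (pow (var 1))) (const 3)))
/-- The digit of `a` at `b`. -/
def dig (a b : Tm) : Tm := call₂ digBody a b

section Arith

variable {M : Mach} {e : List ℕ} {a b : Tm}

theorem sum_range_ite_lt (x m n : ℕ) :
    (∑ i ∈ Finset.range n, if i < m then x else 0) = x * min m n := by
  rw [← Finset.sum_filter, Finset.sum_const, smul_eq_mul, mul_comm]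
  congr 1
  rw [show (Finset.range n).filter (· < m) = Finset.range (min m n) by
    ext i; simp only [Finset.mem_filter, Finset.mem_range]; omega, Finset.card_range]

theorem eval_mul (hb : b.eval M e [] ≤ M.bd) :
    (mul a b).eval M e [] = a.eval M e [] * b.eval M e [] := by
  have h : (mul a b).eval M e [] = accum (fun i _ => if b.eval M e [] - i = 0 then 0
    else a.eval M e []) 0 M.bd := rfl
  rw [h, accum_const, zero_add, ← Nat.min_eq_left hb, ← sum_range_ite_lt, Nat.min_eq_left hb]
  refine Finset.sum_congr rfl fun i _ => ?_
  split_ifs <;> omega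

theorem eval_div (ha : a.eval M e [] ≤ M.bd) (hb : 0 < b.eval M e []) :
    (div a b).eval M e [] = a.eval M e [] / b.eval M e [] := by
  set x := a.eval M e [] with hx
  set y := b.eval M e [] with hy
  have h : (div a b).eval M e [] = accum (fun i _ => (le (mul (var 2) (add (var 0) (const 1)))
    (var 1)).eval M [i, x, y] []) 0 M.bd := rfl
  have hle : x / y ≤ M.bd := (Nat.div_le_self x y).trans ha
  rw [h, accum_const, zero_add, ← one_mul (x / y), ← Nat.min_eq_left hle, ← sum_range_ite_lt]
  refine Finset.sum_congr rfl fun i hi => ?_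
  rw [Finset.mem_range] at hi
  rw [le, eval_neg, eval_sub, eval_mul (by exact hi), show (var 2).eval M [i, x, y] [] = y from rfl,
    show (add (var 0) (const 1)).eval M [i, x, y] [] = i + 1 from rfl,
    show (var 1).eval M [i, x, y] [] = x from rfl]
  refine if_congr ?_ rfl rfl
  rw [Nat.sub_eq_zero_iff_le, Nat.lt_iff_add_one_le, Nat.le_div_iff_mul_le hb, mul_comm]

theorem accum_pow (m n : ℕ) :
    accum (fun i y => if m - i = 0 then 0 else y + y) 1 n = 3 ^ min m n := by
  induction n with
  | zero => simp [accum]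
  | succ n ih =>
    rw [accum, ih]
    split_ifs with h
    · rw [Nat.min_eq_left (by omega), Nat.min_eq_left (by omega), add_zero]
    · rw [Nat.min_eq_right (by omega), Nat.min_eq_right (by omega), pow_succ]; ring

theorem eval_pow' : (pow a).eval M e [] = 3 ^ min (a.eval M e []) M.bd := accum_pow _ _

theorem eval_pow (ha : a.eval M e [] ≤ M.bd) : (pow a).eval M e [] = 3 ^ a.eval M e [] := by
  rw [eval_pow', Nat.min_eq_left ha]

/-- No bound on the position is needed: beyond `M.bd` the power stops at `3 ^ M.bd`, which already
exceeds the number, so the digit is 0 either way. -/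
theorem eval_dig (ha : a.eval M e [] ≤ M.bd) :
    (dig a b).eval M e [] = digit (a.eval M e []) (b.eval M e []) := by
  rw [dig, eval_call₂]
  generalize a.eval M e [] = x at ha
  generalize b.eval M e [] = i
  have hx : (var 0).eval M [x, i] [] = x := rfl
  have hi : (var 1).eval M [x, i] [] = i := rfl
  have hp : (pow (var 1)).eval M [x, i] [] = 3 ^ min i M.bd := by rw [eval_pow', hi]
  have h1 : (div (var 0) (pow (var 1))).eval M [x, i] [] = x / 3 ^ i := by
    rw [eval_div (by rwa [hx]) (by rw [hp]; positivity), hx, hp]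
    rcases le_total i M.bd with h | h
    · rw [Nat.min_eq_left h]
    · have hlt : x < 3 ^ M.bd := ha.trans_lt (Nat.lt_pow_self (by norm_num))
      rw [Nat.min_eq_right h, Nat.div_eq_of_lt hlt,
        Nat.div_eq_of_lt (hlt.trans_le (Nat.pow_le_pow_right (by norm_num) h))]
  have h2 : (div (div (var 0) (pow (var 1))) (const 3)).eval M [x, i] [] = x / 3 ^ i / 3 := by
    rw [eval_div (by rw [h1]; exact (Nat.div_le_self _ _).trans ha) (by rw [eval_const]; norm_num),
      h1, eval_const]
  rw [digBody, eval_sub, h1, eval_mul (by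
    rw [h2]; exact (Nat.div_le_self _ _).trans ((Nat.div_le_self _ _).trans ha)), h2, eval_const,
    digit]
  omega

end Arith

end Tm

/-- The input starts with `n, w, k, m`, and the bound on the loops is large enough for it. -/
structure Params (M : Mach) (n w k m : ℕ) : Prop where
  inp_zero : M.inp 0 = n
  inp_one : M.inp 1 = w
  inp_two : M.inp 2 = k
  inp_three : M.inp 3 = m
  n_le : n ≤ M.bd
  w_le : w ≤ M.bd
  k_lt : k + 1 ≤ M.bd
  pow_le : 3 ^ k ≤ M.bd
  digits_le : (k + 3 ^ k) * w ≤ M.bd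
  states_le : 3 ^ ((k + 3 ^ k) * w) ≤ M.bd
  table_le : (3 ^ ((k + 3 ^ k) * w) + n + 1) * m ≤ M.bd

namespace Tm

/-! ## Terms for the dynamic program -/

def nT : Tm := read (const 0)
def wT : Tm := read (const 1)
def kT : Tm := read (const 2)
def mT : Tm := read (const 3)
/-- The number of colour vectors. -/
def vecT : Tm := pow kT
/-- The number of states. -/
def stateT : Tm := pow (mul (add kT vecT) wT)
/-- The length of the rows of the table. -/
def rowT : Tm := add (add stateT nT) (const 1)

def min2 (a : Tm) : Tm := call₁ (sub (var 0) (sub (var 0) (const 2))) a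
/-- A digit for the label `a` and the colour `c` of the state `x`. -/
def cntT (x a c : Tm) : Tm :=
  call₃ (dig (var 0) (add (mul (add kT vecT) (var 1)) (var 2))) x a c
/-- A digit for the label `a` and the colour vector `t` of the state `x`. -/
def typT (x a t : Tm) : Tm :=
  call₃ (dig (var 0) (add (mul (add kT vecT) (var 1)) (add kT (var 2)))) x a t
def cell (p j : Tm) : Tm := call₂ (load (add (mul rowT (var 0)) (var 1))) p j
-- Behind the entries for the states, a row stores the labels of the `n` vertices and then the size
-- of the subexpression.
def labT (p v : Tm) : Tm := cell p (add stateT v)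
def sizeT (p : Tm) : Tm := cell p (add stateT nT)
/-- The number at position `r` of the operation `p`. -/
def opT (r : ℕ) (p : Tm) : Tm := call₁ (read (add (const 4)
  (add (add (var 0) (add (var 0) (var 0))) (const r)))) p
-- The matrix begins after four parameters and three numbers for each of the `m` operations.
def adjT (u v : Tm) : Tm := call₂ (read (add (const 4) (add (add mT (add mT mT))
  (add (mul nT (var 0)) (var 1))))) u v

/-- There is an edge between label `a` in row `l` and label `b` in row `r`. -/
def crossBody : Tm := -- `u, v, l, r, a, b` inside
  ex nT (ex nT (conj (eq (labT (var 2) (var 1)) (add (var 4) (const 1)))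
    (conj (eq (labT (var 3) (var 0)) (add (var 5) (const 1))) (adjT (var 1) (var 0)))))
-- The double negation reduces a number of witnesses to 0 or 1, as required of the coefficients `S a
-- b` in `UnionStep`.
def crossT (l r a b : Tm) : Tm := neg (neg (call₄ crossBody l r a b))

/-- The arguments are `l, r, y, z, a, τ`; the binders push `σ`, `c` and `b` in front of them. The
inner `ex` serves as a sum over labels. -/
def unionTypeBody : Tm :=
  ex vecT (conj (typT (var 3) (var 5) (var 0)) (all kT (eq (dig (var 7) (var 0))
    (min2 (add (dig (var 1) (var 0)) (ex wT (conj (crossT (var 3) (var 4) (var 7) (var 0))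
      (cntT (var 6) (var 0) (var 1)))))))))

def unionBody : Tm :=
  all wT (conj
    (all kT (eq (cntT (var 6) (var 1) (var 0))
      (min2 (add (cntT (var 4) (var 1) (var 0)) (cntT (var 5) (var 1) (var 0))))))
    (all vecT (iff (typT (var 6) (var 1) (var 0))
      (disj (call₆ unionTypeBody (var 2) (var 3) (var 4) (var 5) (var 1) (var 0))
        (call₆ unionTypeBody (var 3) (var 2) (var 5) (var 4) (var 1) (var 0))))))

def relabelBody : Tm :=
  all wT (conj
    (all kT (eq (cntT (var 5) (var 1) (var 0)) (min2 (ite (eq (var 1) (var 2)) (const 0)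
      (add (cntT (var 4) (var 1) (var 0))
        (ite (eq (var 1) (var 3)) (cntT (var 4) (var 2) (var 0)) (const 0)))))))
    (all vecT (iff (typT (var 5) (var 1) (var 0)) (conj (neg (eq (var 1) (var 2)))
      (disj (typT (var 4) (var 1) (var 0))
        (conj (eq (var 1) (var 3)) (typT (var 4) (var 2) (var 0))))))))

def vertexBody (cl : ℕ) : Tm :=
  all wT (conj
    (all kT (eq (cntT (var 4) (var 1) (var 0))
      (ite (conj (eq (var 1) (var 2)) (eq (var 3) (add (var 0) (const 1)))) (const 1) (const 0))))
    (all vecT (iff (typT (var 4) (var 1) (var 0)) (conj (eq (var 1) (var 2))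
      (all kT (eq (dig (var 1) (var 0)) (ite (conj (eq (const cl) (const 1))
        (eq (var 4) (add (var 0) (const 1)))) (const 1) (const 0))))))))

/-- In postfix order, the operation before `p` is the last one of its only or right argument. -/
def prev (p : Tm) : Tm := sub p (const 1)
/-- The last operation of the left argument of the operation `p`. -/
def left (p : Tm) : Tm := call₁ (sub (prev (var 0)) (sizeT (prev (var 0)))) p

def tableBody (cl lo : ℕ) : Tm :=
  ite (eq (opT 0 (var 0)) (const 0))
    (ex (add kT (const 1)) (conj (le (const lo) (var 0))
      (call₃ (vertexBody cl) (opT 2 (var 1)) (var 0) (var 2))))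
  (ite (eq (opT 0 (var 0)) (const 1))
    (ex stateT (ex stateT (conj (cell (left (var 2)) (var 1)) (conj (cell (prev (var 2)) (var 0))
      (call₅ unionBody (left (var 2)) (prev (var 2)) (var 1) (var 0) (var 3))))))
  (ite (eq (opT 0 (var 0)) (const 2))
    (ex stateT (conj (cell (prev (var 1)) (var 0))
      (call₄ relabelBody (opT 1 (var 1)) (opT 2 (var 1)) (var 0) (var 2))))
  -- A join copies the row, since states already refer to neighbourhoods in the final graph.
  (cell (prev (var 0)) (var 1))))

def labBody : Tm :=
  ite (eq (opT 0 (var 0)) (const 0))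
    (ite (eq (var 1) (opT 1 (var 0))) (add (opT 2 (var 0)) (const 1)) (const 0))
  (ite (eq (opT 0 (var 0)) (const 1))
    (add (labT (left (var 0)) (var 1)) (labT (prev (var 0)) (var 1)))
  (ite (eq (opT 0 (var 0)) (const 2))
    (ite (eq (labT (prev (var 0)) (var 1)) (add (opT 1 (var 0)) (const 1)))
      (add (opT 2 (var 0)) (const 1)) (labT (prev (var 0)) (var 1)))
  (labT (prev (var 0)) (var 1))))

def sizeBody : Tm :=
  ite (eq (opT 0 (var 0)) (const 0)) (const 1)
  (ite (eq (opT 0 (var 0)) (const 1))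
    (add (add (sizeT (left (var 0))) (sizeT (prev (var 0)))) (const 1))
  (add (sizeT (prev (var 0))) (const 1)))

/-- The entry at position `j` of row `p` of the table. -/
def stepBody (cl lo : ℕ) : Tm :=
  ite (lt (var 1) stateT) (call₂ (tableBody cl lo) (var 0) (var 1))
  (ite (lt (var 1) (add stateT nT)) (call₂ labBody (var 0) (sub (var 1) stateT))
  (call₁ sizeBody (var 0)))

/-- Division with remainder by the row length recovers row and column from the address. -/
def stepT (cl lo : ℕ) : Tm :=
  call₂ (stepBody cl lo) (div (var 0) rowT) (sub (var 0) (mul rowT (div (var 0) rowT)))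

def goodBody : Tm :=
  all wT (all vecT (disj (neg (typT (var 2) (var 1) (var 0)))
    (ex kT (eq (dig (var 1) (var 0)) (const 1)))))

/-- The expression itself ends at the last operation. The double negation makes the answer exactly 0
or 1. -/
def answerT : Tm :=
  neg (neg (ex stateT (conj (cell (prev mT) (var 0)) (call₁ goodBody (var 0)))))

end Tm

/-- The entry at position `j` of row `p` of the table. -/
def row (n w k : ℕ) (f : ℕ → ℕ) (p j : ℕ) : ℕ := f ((3 ^ ((k + 3 ^ k) * w) + n + 1) * p + j)

/-! ### Values of the terms for the dynamic program -/

namespace Tm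

variable {M : Mach} {n w k m : ℕ} {e : List ℕ}

theorem eval_nT (hp : Params M n w k m) : nT.eval M e [] = n := hp.inp_zero
theorem eval_wT (hp : Params M n w k m) : wT.eval M e [] = w := hp.inp_one
theorem eval_kT (hp : Params M n w k m) : kT.eval M e [] = k := hp.inp_two
theorem eval_mT (hp : Params M n w k m) : mT.eval M e [] = m := hp.inp_three

theorem eval_vecT (hp : Params M n w k m) : vecT.eval M e [] = 3 ^ k := by
  have := hp.k_lt
  rw [vecT, eval_pow (by rw [eval_kT hp]; omega), eval_kT hp]

theorem eval_stateT (hp : Params M n w k m) :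
    stateT.eval M e [] = 3 ^ ((k + 3 ^ k) * w) := by
  have h : (mul (add kT vecT) wT).eval M e [] = (k + 3 ^ k) * w := by
    rw [eval_mul (by rw [eval_wT hp]; exact hp.w_le), eval_add, eval_kT hp, eval_vecT hp,
      eval_wT hp]
  rw [stateT, eval_pow (by rw [h]; exact hp.digits_le), h]

theorem eval_rowT (hp : Params M n w k m) :
    rowT.eval M e [] = 3 ^ ((k + 3 ^ k) * w) + n + 1 := by
  rw [rowT, eval_add, eval_add, eval_stateT hp, eval_nT hp, eval_const]

theorem eval_min2 {a : Tm} : (min2 a).eval M e [] = min 2 (a.eval M e []) := by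
  have h : (min2 a).eval M e [] = a.eval M e [] - (a.eval M e [] - 2) := rfl
  omega

theorem eval_cntT (hp : Params M n w k m) {x a c : Tm} (hx : x.eval M e [] ≤ M.bd)
    (ha : a.eval M e [] ≤ M.bd) :
    (cntT x a c).eval M e [] = cnt k (x.eval M e []) (a.eval M e []) (c.eval M e []) := by
  rw [cntT, eval_call₃, eval_dig (by exact hx), eval_add, eval_mul (by exact ha), eval_add,
    eval_kT hp, eval_vecT hp]
  rfl

theorem eval_typT (hp : Params M n w k m) {x a t : Tm} (hx : x.eval M e [] ≤ M.bd)
    (ha : a.eval M e [] ≤ M.bd) :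
    (typT x a t).eval M e [] = typ k (x.eval M e []) (a.eval M e []) (t.eval M e []) := by
  rw [typT, eval_call₃, eval_dig (by exact hx), eval_add, eval_mul (by exact ha), eval_add,
    eval_add, eval_kT hp,
    eval_vecT hp]
  rfl

theorem holds_typT (hp : Params M n w k m) {x a t : Tm} (hx : x.eval M e [] ≤ M.bd)
    (ha : a.eval M e [] ≤ M.bd) :
    Holds M (typT x a t) e ↔ typ k (x.eval M e []) (a.eval M e []) (t.eval M e []) ≠ 0 := by
  rw [Holds, eval_typT hp hx ha]

theorem eval_cell (hp : Params M n w k m) {p j : Tm} (h : p.eval M e [] ≤ M.bd) :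
    (cell p j).eval M e [] = row n w k M.mem (p.eval M e []) (j.eval M e []) := by
  have h' : (cell p j).eval M e [] = M.mem ((add (mul rowT (var 0)) (var 1)).eval M
    [p.eval M e [], j.eval M e []] []) := rfl
  rw [h', eval_add, eval_mul (by exact h), eval_rowT hp]
  rfl

theorem eval_labT (hp : Params M n w k m) {p v : Tm} (h : p.eval M e [] ≤ M.bd) :
    (labT p v).eval M e [] =
      row n w k M.mem (p.eval M e []) (3 ^ ((k + 3 ^ k) * w) + v.eval M e []) := by
  rw [labT, eval_cell hp h, eval_add, eval_stateT hp]

theorem eval_sizeT (hp : Params M n w k m) {p : Tm} (h : p.eval M e [] ≤ M.bd) :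
    (sizeT p).eval M e [] = row n w k M.mem (p.eval M e []) (3 ^ ((k + 3 ^ k) * w) + n) := by
  rw [sizeT, eval_cell hp h, eval_add, eval_stateT hp, eval_nT hp]

theorem eval_opT {r : ℕ} {p : Tm} :
    (opT r p).eval M e [] = M.inp (4 + (3 * p.eval M e [] + r)) := by
  have h : (opT r p).eval M e [] =
    M.inp (4 + (p.eval M e [] + (p.eval M e [] + p.eval M e []) + r)) := rfl
  rw [h]
  congr 2
  ring

theorem eval_adjT (hp : Params M n w k m) {u v : Tm} (h : u.eval M e [] ≤ M.bd) :
    (adjT u v).eval M e [] = M.inp (4 + (3 * m + (n * u.eval M e [] + v.eval M e []))) := by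
  have h' : (adjT u v).eval M e [] = M.inp (4 + ((mT.eval M [u.eval M e [], v.eval M e []] [] +
    (mT.eval M [u.eval M e [], v.eval M e []] [] + mT.eval M [u.eval M e [], v.eval M e []] [])) +
      ((mul nT (var 0)).eval M [u.eval M e [], v.eval M e []] [] + v.eval M e []))) := rfl
  rw [h', eval_mul (by exact h), eval_nT hp, eval_mT hp]
  congr 2
  rw [show m + (m + m) = 3 * m by ring]
  rfl

theorem holds_crossBody (hp : Params M n w k m) {l r a b : ℕ} (hl : l ≤ M.bd) (hr : r ≤ M.bd) :
    Holds M crossBody [l, r, a, b] ↔ ∃ u < n, ∃ v < n,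
      row n w k M.mem l (3 ^ ((k + 3 ^ k) * w) + u) = a + 1 ∧
      row n w k M.mem r (3 ^ ((k + 3 ^ k) * w) + v) = b + 1 ∧
      M.inp (4 + (3 * m + (n * u + v))) ≠ 0 := by
  rw [crossBody, holds_ex (fun _ => eval_nT hp) hp.n_le]
  refine exists_congr fun u => and_congr_right fun hu => ?_
  rw [holds_ex (fun _ => eval_nT hp) hp.n_le]
  refine exists_congr fun v => and_congr_right fun hv => ?_
  rw [holds_conj, holds_conj, holds_eq, holds_eq, eval_labT hp (by exact hl),
    eval_labT hp (by exact hr), Holds, eval_adjT hp (by exact hu.le.trans hp.n_le)]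
  rfl

/-- `1` if there is an edge between label `a` in row `l` and label `b` in row `r`, and `0`
otherwise. -/
def cross (M : Mach) (l r a b : ℕ) : ℕ := (neg (neg crossBody)).eval M [l, r, a, b] []

theorem cross_eq_one {l r a b : ℕ} : cross M l r a b = 1 ↔ Holds M crossBody [l, r, a, b] := by
  rw [cross, eval_neg, eval_neg, Holds]; split_ifs with h h' h' <;> simp_all

theorem cross_le_one {l r a b : ℕ} : cross M l r a b ≤ 1 := by
  rw [cross, eval_neg]; split_ifs <;> simp

theorem eval_crossT {l r a b : Tm} : (crossT l r a b).eval M e [] =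
    cross M (l.eval M e []) (r.eval M e []) (a.eval M e []) (b.eval M e []) := rfl

theorem holds_unionTypeBody (hp : Params M n w k m) {l r y z a τ : ℕ} (hy : y ≤ M.bd)
    (hz : z ≤ M.bd) (ha : a ≤ M.bd) (hτ : τ ≤ M.bd) :
    Holds M unionTypeBody [l, r, y, z, a, τ] ↔ UnionType w k (cross M l r a) y z a τ := by
  have hk := hp.k_lt
  rw [unionTypeBody, holds_ex (fun _ => eval_vecT hp) hp.pow_le]
  refine exists_congr fun σ => and_congr_right fun hσ => ?_
  rw [holds_conj, holds_typT hp (by exact hy) (by exact ha),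
    holds_all (fun _ => eval_kT hp) (by omega)]
  refine and_congr Iff.rfl (forall₂_congr fun c hc => ?_)
  rw [holds_eq, eval_dig (by exact hτ), eval_min2, eval_add,
    eval_dig (by exact hσ.le.trans hp.pow_le), eval_ex (fun _ => eval_wT hp) hp.w_le]
  -- Since `cross` is 0 or 1, the conjunction is a product.
  have hsum : (∑ b ∈ Finset.range w, (conj (crossT (var 3) (var 4) (var 7) (var 0))
      (cntT (var 6) (var 0) (var 1))).eval M (b :: c :: σ :: [l, r, y, z, a, τ]) []) =
      ∑ b ∈ Finset.range w, cross M l r a b * cnt k z b c := by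
    refine Finset.sum_congr rfl fun b hb => ?_
    rw [Finset.mem_range] at hb
    rw [eval_conj, eval_cntT hp (by exact hz) (by exact hb.le.trans hp.w_le), eval_crossT]
    change (if cross M l r a b = 0 then 0 else cnt k z b c) = _
    have := cross_le_one (M := M) (l := l) (r := r) (a := a) (b := b)
    split_ifs with h
    · simp [h]
    · rw [show cross M l r a b = 1 by omega, one_mul]
  rw [hsum]
  rfl

theorem holds_unionBody (hp : Params M n w k m) {l r y z x : ℕ} (hy : y ≤ M.bd)
    (hz : z ≤ M.bd) (hx : x ≤ M.bd) :
    Holds M unionBody [l, r, y, z, x] ↔ UnionStep w k (cross M l r) (cross M r l) y z x := by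
  have hk := hp.k_lt
  rw [unionBody, holds_all (fun _ => eval_wT hp) hp.w_le]
  refine forall₂_congr fun a ha => ?_
  have ha' : a ≤ M.bd := ha.le.trans hp.w_le
  rw [holds_conj, holds_all (fun _ => eval_kT hp) (by omega),
    holds_all (fun _ => eval_vecT hp) hp.pow_le]
  refine and_congr (forall₂_congr fun c hc => ?_) (forall₂_congr fun τ hτ => ?_)
  · rw [holds_eq, eval_min2, eval_add, eval_cntT hp (by exact hx) (by exact ha'),
      eval_cntT hp (by exact hy) (by exact ha'), eval_cntT hp (by exact hz) (by exact ha')]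
    rfl
  · have hτ' : τ ≤ M.bd := hτ.le.trans hp.pow_le
    rw [holds_iff, holds_disj, holds_call₆, holds_call₆, holds_typT hp (by exact hx) (by exact ha')]
    exact iff_congr Iff.rfl (or_congr (holds_unionTypeBody hp hy hz ha' hτ')
      (holds_unionTypeBody hp hz hy ha' hτ'))

theorem holds_relabelBody (hp : Params M n w k m) {i j y x : ℕ} (hi : i ≤ M.bd) (hy : y ≤ M.bd)
    (hx : x ≤ M.bd) : Holds M relabelBody [i, j, y, x] ↔ RelabelStep w k i j y x := by
  have hk := hp.k_lt
  rw [relabelBody, holds_all (fun _ => eval_wT hp) hp.w_le]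
  refine forall₂_congr fun a ha => ?_
  have ha' : a ≤ M.bd := ha.le.trans hp.w_le
  rw [holds_conj, holds_all (fun _ => eval_kT hp) (by omega),
    holds_all (fun _ => eval_vecT hp) hp.pow_le]
  refine and_congr (forall₂_congr fun c hc => ?_) (forall₂_congr fun τ hτ => ?_)
  · rw [holds_eq, eval_min2, eval_ite, eval_add, eval_ite,
      eval_cntT hp (by exact hx) (by exact ha'), eval_cntT hp (by exact hy) (by exact ha'),
      eval_cntT hp (by exact hy) (by exact hi)]
    simp only [holds_eq]
    change cnt k x a c = min 2 (if a = i then 0 else cnt k y a c + if a = j then cnt k y i c else 0)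
      ↔ _
    rfl
  · rw [holds_iff, holds_conj, holds_disj, holds_conj, holds_neg, holds_eq, holds_eq,
      holds_typT hp (by exact hx) (by exact ha'), holds_typT hp (by exact hy) (by exact ha'),
      holds_typT hp (by exact hy) (by exact hi)]
    rfl

theorem holds_vertexBody (hp : Params M n w k m) {cl i d x : ℕ} (hx : x ≤ M.bd) :
    Holds M (vertexBody cl) [i, d, x] ↔ VertexStep cl w k i d x := by
  have hk := hp.k_lt
  rw [vertexBody, holds_all (fun _ => eval_wT hp) hp.w_le]
  refine forall₂_congr fun a ha => ?_
  have ha' : a ≤ M.bd := ha.le.trans hp.w_le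
  rw [holds_conj, holds_all (fun _ => eval_kT hp) (by omega),
    holds_all (fun _ => eval_vecT hp) hp.pow_le]
  refine and_congr (forall₂_congr fun c hc => ?_) (forall₂_congr fun τ hτ => ?_)
  · rw [holds_eq, eval_ite, eval_cntT hp (by exact hx) (by exact ha')]
    simp only [holds_conj, holds_eq]
    change cnt k x a c = (if a = i ∧ d = c + 1 then 1 else 0) ↔ _
    rfl
  · rw [holds_iff, holds_conj, holds_eq, holds_typT hp (by exact hx) (by exact ha'),
      holds_all (fun _ => eval_kT hp) (by omega)]
    refine iff_congr Iff.rfl (and_congr Iff.rfl (forall₂_congr fun c hc => ?_))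
    rw [holds_eq, eval_ite, eval_dig (by exact hτ.le.trans hp.pow_le)]
    simp only [holds_conj, holds_eq]
    change digit τ c = (if cl = 1 ∧ d = c + 1 then 1 else 0) ↔ _
    rfl

theorem holds_goodBody (hp : Params M n w k m) {x : ℕ} (hx : x ≤ M.bd) :
    Holds M goodBody [x] ↔ GoodState w k x := by
  have hk := hp.k_lt
  rw [goodBody, holds_all (fun _ => eval_wT hp) hp.w_le]
  refine forall₂_congr fun a ha => ?_
  rw [holds_all (fun _ => eval_vecT hp) hp.pow_le]
  refine forall₂_congr fun τ hτ => ?_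
  rw [holds_disj, holds_neg, holds_typT hp (by exact hx) (by exact ha.le.trans hp.w_le),
    holds_ex (fun _ => eval_kT hp) (by omega), ← imp_iff_not_or]
  refine imp_congr Iff.rfl (exists_congr fun c => and_congr_right fun hc => ?_)
  rw [holds_eq, eval_dig (by exact hτ.le.trans hp.pow_le)]
  rfl

end Tm

/-- The neighbourhoods of `G`, closed ones if `cl = 1`, and open ones otherwise. -/
def Near {V : Type*} (cl : ℕ) (G : SimpleGraph V) (v u : V) : Prop := G.Adj v u ∨ cl = 1 ∧ v = u

/-- The numbers `f j` form the row of the table for the expression `Ψ`. -/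
structure IsRow {n w : ℕ} (G : SimpleGraph (Fin n)) (cl lo k : ℕ) (f : ℕ → ℕ)
    (Ψ : CWExpr (Fin n) w) : Prop where
  states : ∀ x < 3 ^ ((k + 3 ^ k) * w), (f x ≠ 0 ↔ Realizable (Near cl G) lo w k Ψ.lab x)
  labels : ∀ v : Fin n, f (3 ^ ((k + 3 ^ k) * w) + v) = Ψ.lab v
  size : f (3 ^ ((k + 3 ^ k) * w) + n) = Ψ.size

/-! ### Correctness of a row for each operation -/

namespace Tm

variable {M : Mach} {n w k m p cl lo : ℕ} {G : SimpleGraph (Fin n)} {Φ Ψ : CWExpr (Fin n) w}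

theorem eval_prev {e : List ℕ} {a : Tm} : (prev a).eval M e [] = a.eval M e [] - 1 := rfl

theorem eval_left (hp : Params M n w k m) {e : List ℕ} {a : Tm} (ha : a.eval M e [] ≤ M.bd) :
    (left a).eval M e [] = a.eval M e [] - 1 -
      row n w k M.mem (a.eval M e [] - 1) (3 ^ ((k + 3 ^ k) * w) + n) := by
  rw [left, eval_call₁, eval_sub, eval_sizeT hp ((Nat.sub_le _ _).trans ha)]
  rfl

theorem isRow_stepBody (hp : Params M n w k m)
    (hT : ∀ x < 3 ^ ((k + 3 ^ k) * w), (Holds M (tableBody cl lo) [p, x] ↔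
      Realizable (Near cl G) lo w k Ψ.lab x))
    (hl : ∀ v : Fin n, labBody.eval M [p, v] [] = Ψ.lab v)
    (hs : sizeBody.eval M [p] [] = Ψ.size) :
    IsRow G cl lo k (fun j => (stepBody cl lo).eval M [p, j] []) Ψ := by
  set X := 3 ^ ((k + 3 ^ k) * w) with hX
  have key : ∀ j, (stepBody cl lo).eval M [p, j] [] =
      if j < X then (tableBody cl lo).eval M [p, j] []
      else if j < X + n then labBody.eval M [p, j - X] [] else sizeBody.eval M [p] [] := by
    intro j
    rw [stepBody, eval_ite, eval_ite, eval_call₂, eval_call₂, eval_call₁, eval_sub, eval_stateT hp]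
    simp only [holds_lt, eval_add, eval_stateT hp, eval_nT hp]
    rfl
  refine ⟨fun x hx => ?_, fun v => ?_, ?_⟩
  · rw [key, if_pos hx]; exact hT x hx
  · rw [key, if_neg (by omega), if_pos (by omega), Nat.add_sub_cancel_left, hl]
  · rw [key, if_neg (by omega), if_neg (by omega), hs]

theorem isRow_vertex (hp : Params M n w k m) {v : Fin n} {i : Fin w}
    (h0 : M.inp (4 + (3 * p + 0)) = 0) (h1 : M.inp (4 + (3 * p + 1)) = v)
    (h2 : M.inp (4 + (3 * p + 2)) = i) :
    IsRow G cl lo k (fun j => (stepBody cl lo).eval M [p, j] []) (.vertex v i) := by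
  have hk : Holds M (eq (opT 0 (var 0)) (const 0)) [p] := by
    rw [holds_eq, eval_opT]; exact h0
  have hk' : ∀ j, Holds M (eq (opT 0 (var 0)) (const 0)) [p, j] := by
    intro j; rw [holds_eq, eval_opT]; exact h0
  refine isRow_stepBody hp (fun x hx => ?_) (fun u => ?_) ?_
  · rw [realizable_vertex (cl := cl) (v := v) (i := i) (by simp [Near])
      (fun u => CWExpr.lab_vertex v u i), tableBody, holds_ite_pos (hk' x), holds_ex (m := k + 1)
        (fun _ => by rw [eval_add, eval_kT hp, eval_const]) hp.k_lt]
    refine exists_congr fun d => and_congr (Nat.lt_succ_iff) ?_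
    rw [holds_conj, holds_le, holds_call₃, eval_opT]
    refine and_congr Iff.rfl ?_
    rw [show M.inp (4 + (3 * (var 1).eval M [d, p, x] [] + 2)) = i from h2]
    exact holds_vertexBody hp (hx.le.trans hp.states_le)
  · rw [labBody, eval_ite_pos (hk' _), eval_ite, CWExpr.lab_vertex, eval_add, eval_opT]
    simp only [holds_eq, eval_opT]
    change (if (u : ℕ) = M.inp (4 + (3 * p + 1)) then M.inp (4 + (3 * p + 2)) + 1 else 0) = _
    rw [h1, h2]
    simp only [Fin.ext_iff]
  · rw [sizeBody, eval_ite_pos hk]; rfl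

theorem isRow_relabel (hp : Params M n w k m) (hpb : p ≤ M.bd) {i j : Fin w} (hij : i ≠ j)
    (h0 : M.inp (4 + (3 * p + 0)) = 2) (h1 : M.inp (4 + (3 * p + 1)) = i)
    (h2 : M.inp (4 + (3 * p + 2)) = j) (hr : IsRow G cl lo k (row n w k M.mem (p - 1)) Ψ) :
    IsRow G cl lo k (fun j => (stepBody cl lo).eval M [p, j] []) (.relabel i j hij Ψ) := by
  have hk : ∀ e c, Holds M (eq (opT 0 (var 0)) (const c)) (p :: e) ↔ c = 2 := by
    intro e c; rw [holds_eq, eval_opT, eq_comm]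
    change c = M.inp (4 + (3 * p + 0)) ↔ _
    rw [h0]
  have hn : ∀ c, c ≠ 2 → ∀ e, ¬ Holds M (eq (opT 0 (var 0)) (const c)) (p :: e) :=
    fun c hc e h => hc ((hk e c).1 h)
  have hpb' : p - 1 ≤ M.bd := (Nat.sub_le _ _).trans hpb
  refine isRow_stepBody hp (fun x hx => ?_) (fun u => ?_) ?_
  · rw [realizable_relabel i.2 (Fin.val_injective.ne hij)
      (fun u => CWExpr.lab_relabel i j hij Ψ u), tableBody, holds_ite_neg (hn 0 (by decide) _),
      holds_ite_neg (hn 1 (by decide) _), holds_ite_pos ((hk _ 2).2 rfl),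
      holds_ex (fun _ => eval_stateT hp) hp.states_le]
    refine exists_congr fun y => and_congr_right fun hy => ?_
    rw [holds_conj, Holds, eval_cell hp (by exact hpb'), holds_call₄, eval_opT, eval_opT]
    refine and_congr (hr.states y hy) ?_
    rw [show M.inp (4 + (3 * (var 1).eval M [y, p, x] [] + 1)) = i from h1,
      show M.inp (4 + (3 * (var 1).eval M [y, p, x] [] + 2)) = j from h2]
    exact holds_relabelBody hp (i.2.le.trans hp.w_le) (hy.le.trans hp.states_le)
      (hx.le.trans hp.states_le)
  · rw [labBody, eval_ite_neg (hn 0 (by decide) _), eval_ite_neg (hn 1 (by decide) _),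
      eval_ite_pos ((hk _ 2).2 rfl), eval_ite, eval_add, eval_opT]
    simp only [holds_eq, eval_opT, eval_add, eval_labT hp (show
      (prev (var 0)).eval M [p, (u : ℕ)] [] ≤ M.bd from hpb')]
    change (if row n w k M.mem (p - 1) (3 ^ ((k + 3 ^ k) * w) + u) =
        M.inp (4 + (3 * p + 1)) + 1 then M.inp (4 + (3 * p + 2)) + 1
      else row n w k M.mem (p - 1) (3 ^ ((k + 3 ^ k) * w) + u)) = _
    rw [h1, h2, hr.labels, CWExpr.lab_relabel]
  · rw [sizeBody, eval_ite_neg (hn 0 (by decide) _), eval_ite_neg (hn 1 (by decide) _), eval_add,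
      eval_sizeT hp (by exact hpb')]
    change row n w k M.mem (p - 1) (3 ^ ((k + 3 ^ k) * w) + n) + 1 = _
    rw [hr.size]; rfl

theorem isRow_join (hp : Params M n w k m) (hpb : p ≤ M.bd) {i j : Fin w} (hij : i ≠ j)
    (h0 : M.inp (4 + (3 * p + 0)) = 3) (hr : IsRow G cl lo k (row n w k M.mem (p - 1)) Ψ) :
    IsRow G cl lo k (fun j => (stepBody cl lo).eval M [p, j] []) (.join i j hij Ψ) := by
  have hk : ∀ e c, Holds M (eq (opT 0 (var 0)) (const c)) (p :: e) ↔ c = 3 := by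
    intro e c; rw [holds_eq, eval_opT, eq_comm]
    change c = M.inp (4 + (3 * p + 0)) ↔ _
    rw [h0]
  have hn : ∀ c, c ≠ 3 → ∀ e, ¬ Holds M (eq (opT 0 (var 0)) (const c)) (p :: e) :=
    fun c hc e h => hc ((hk e c).1 h)
  have hpb' : p - 1 ≤ M.bd := (Nat.sub_le _ _).trans hpb
  refine isRow_stepBody hp (fun x hx => ?_) (fun u => ?_) ?_
  · rw [tableBody, holds_ite_neg (hn 0 (by decide) _), holds_ite_neg (hn 1 (by decide) _),
      holds_ite_neg (hn 2 (by decide) _), Holds, eval_cell hp (by exact hpb')]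
    exact hr.states x hx
  · rw [labBody, eval_ite_neg (hn 0 (by decide) _), eval_ite_neg (hn 1 (by decide) _),
      eval_ite_neg (hn 2 (by decide) _), eval_labT hp (by exact hpb')]
    exact hr.labels u
  · rw [sizeBody, eval_ite_neg (hn 0 (by decide) _), eval_ite_neg (hn 1 (by decide) _), eval_add,
      eval_sizeT hp (by exact hpb')]
    change row n w k M.mem (p - 1) (3 ^ ((k + 3 ^ k) * w) + n) + 1 = _
    rw [hr.size]; rfl

/-- By uniformity, one adjacent pair with labels `a` and `b` speaks for all such pairs, so a search
for one decides. The sides are disjoint, hence `u ≠ v` and closed neighbourhoods add nothing here.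
-/
theorem cross_iff (hp : Params M n w k m)
    (hG : ∀ u v : Fin n, M.inp (4 + (3 * m + (n * u + v))) ≠ 0 ↔ G.Adj u v) {l r : ℕ}
    (hl : l ≤ M.bd) (hr : r ≤ M.bd) (hlr : IsRow G cl lo k (row n w k M.mem l) Φ)
    (hrr : IsRow G cl lo k (row n w k M.mem r) Ψ) {R : Fin w → Fin w → Prop}
    (hR : ∀ u v a b, Φ.label u = some a → Ψ.label v = some b → (G.Adj u v ↔ R a b))
    (hd : ∀ u, Φ.label u = none ∨ Ψ.label u = none) {u v : Fin n} {a b : ℕ}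
    (hu : Φ.lab u = a + 1) (hv : Ψ.lab v = b + 1) : Near cl G u v ↔ cross M l r a b = 1 := by
  have ha : a < w := by have := Φ.lab_le u; omega
  have hb : b < w := by have := Ψ.lab_le v; omega
  lift a to Fin w using ha
  lift b to Fin w using hb
  rw [CWExpr.lab_eq_succ] at hu hv
  rw [cross_eq_one, holds_crossBody hp hl hr]
  have hne : u ≠ v := by
    rintro rfl
    rcases hd u with h | h <;> simp_all
  rw [Near, or_iff_left (fun h => hne h.2)]
  constructor
  · exact fun h => ⟨u, u.2, v, v.2, by rw [hlr.labels, CWExpr.lab_eq_succ, hu],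
      by rw [hrr.labels, CWExpr.lab_eq_succ, hv], (hG u v).2 h⟩
  · rintro ⟨u', hu', v', hv', h1, h2, h3⟩
    lift u' to Fin n using hu'
    lift v' to Fin n using hv'
    rw [hlr.labels, CWExpr.lab_eq_succ] at h1
    rw [hrr.labels, CWExpr.lab_eq_succ] at h2
    rw [hG, hR u' v' a b h1 h2] at h3
    rwa [hR u v a b hu hv]

theorem isRow_union (hp : Params M n w k m) (hpb : p ≤ M.bd)
    (hG : ∀ u v : Fin n, M.inp (4 + (3 * m + (n * u + v))) ≠ 0 ↔ G.Adj u v)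
    (h0 : M.inp (4 + (3 * p + 0)) = 1)
    (hrr : IsRow G cl lo k (row n w k M.mem (p - 1)) Ψ)
    (hlr : IsRow G cl lo k (row n w k M.mem (p - 1 - Ψ.size)) Φ)
    (hd : ∀ u, Φ.label u = none ∨ Ψ.label u = none) {R : Fin w → Fin w → Prop}
    (hR : ∀ u v a b, Φ.label u = some a → Ψ.label v = some b → (G.Adj u v ↔ R a b)) :
    IsRow G cl lo k (fun j => (stepBody cl lo).eval M [p, j] []) (.union Φ Ψ) := by
  have hk : ∀ e c, Holds M (eq (opT 0 (var 0)) (const c)) (p :: e) ↔ c = 1 := by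
    intro e c; rw [holds_eq, eval_opT, eq_comm]
    change c = M.inp (4 + (3 * p + 0)) ↔ _
    rw [h0]
  have hn : ∀ c, c ≠ 1 → ∀ e, ¬ Holds M (eq (opT 0 (var 0)) (const c)) (p :: e) :=
    fun c hc e h => hc ((hk e c).1 h)
  have hrb : p - 1 ≤ M.bd := (Nat.sub_le _ _).trans hpb
  have hlb : p - 1 - Ψ.size ≤ M.bd := (Nat.sub_le _ _).trans hrb
  -- The stored size of the right argument tells how far back the left argument ends.
  have hleft : ∀ e i, (var i).eval M e [] = p →
      (left (var i)).eval M e [] = p - 1 - Ψ.size := by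
    intro e i h
    rw [eval_left hp (by rwa [h]), h, hrr.size]
  refine isRow_stepBody hp (fun x hx => ?_) (fun u => ?_) ?_
  · have hR' : ∀ u v a b, Ψ.label u = some a → Φ.label v = some b → (G.Adj u v ↔ R b a) :=
      fun u v a b hu hv => by rw [G.adj_comm, hR v u b a hv hu]
    have hd' : ∀ u, Ψ.label u = none ∨ Φ.label u = none := fun u => (hd u).symm
    rw [realizable_union (S := cross M (p - 1 - Ψ.size) (p - 1))
      (S' := cross M (p - 1) (p - 1 - Ψ.size))
      (fun u => (hd u).imp CWExpr.lab_eq_zero.2 CWExpr.lab_eq_zero.2)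
      (CWExpr.lab_union hd) Φ.lab_le Ψ.lab_le
      (fun u v a b hu hv => cross_iff hp hG hlb hrb hlr hrr hR hd hu hv)
      (fun _ _ => cross_le_one)
      (fun u v a b hu hv => cross_iff hp hG hrb hlb hrr hlr hR' hd' hu hv)
      (fun _ _ => cross_le_one), tableBody, holds_ite_neg (hn 0 (by decide) _),
      holds_ite_pos ((hk _ 1).2 rfl),
      holds_ex (fun _ => eval_stateT hp) hp.states_le]
    refine exists_congr fun y => and_congr_right fun hy => ?_
    rw [holds_ex (fun _ => eval_stateT hp) hp.states_le]
    refine exists_congr fun z => and_congr_right fun hz => ?_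
    have hl2 := hleft [z, y, p, x] 2 rfl
    rw [holds_conj, holds_conj, Holds, eval_cell hp (by rw [hl2]; exact hlb), hl2, Holds,
      eval_cell hp (by exact hrb), holds_call₅, hl2]
    exact and_congr (hlr.states y hy) (and_congr (hrr.states z hz) (holds_unionBody hp
      (hy.le.trans hp.states_le) (hz.le.trans hp.states_le) (hx.le.trans hp.states_le)))
  · have hl0 := hleft [p, (u : ℕ)] 0 rfl
    rw [labBody, eval_ite_neg (hn 0 (by decide) _), eval_ite_pos ((hk _ 1).2 rfl)]
    simp only [eval_add, eval_labT hp (show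
      (prev (var 0)).eval M [p, (u : ℕ)] [] ≤ M.bd from hrb), eval_labT hp (show
      (left (var 0)).eval M [p, (u : ℕ)] [] ≤ M.bd by rw [hl0]; exact hlb), hl0]
    change row n w k M.mem (p - 1 - Ψ.size) (3 ^ ((k + 3 ^ k) * w) + u) +
      row n w k M.mem (p - 1) (3 ^ ((k + 3 ^ k) * w) + u) = _
    rw [hlr.labels, hrr.labels, CWExpr.lab_union hd]
  · have hl0 := hleft [p] 0 rfl
    rw [sizeBody, eval_ite_neg (hn 0 (by decide) _), eval_ite_pos ((hk _ 1).2 rfl)]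
    simp only [eval_add, eval_sizeT hp (show
      (prev (var 0)).eval M [p] [] ≤ M.bd from hrb), eval_sizeT hp (show
      (left (var 0)).eval M [p] [] ≤ M.bd by rw [hl0]; exact hlb), hl0]
    change row n w k M.mem (p - 1 - Ψ.size) (3 ^ ((k + 3 ^ k) * w) + n) +
      row n w k M.mem (p - 1) (3 ^ ((k + 3 ^ k) * w) + n) + 1 = _
    rw [hlr.size, hrr.size]; rfl

end Tm

/-! ### Correctness of the whole table -/

theorem Params.of_bound {inp mem : ℕ → ℕ} {n w k m B : ℕ} (h0 : inp 0 = n) (h1 : inp 1 = w)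
    (h2 : inp 2 = k) (h3 : inp 3 = m) (hn : n ≤ m) (hw : 1 ≤ w) (hm : 1 ≤ m)
    (hB : B = m ^ 2 * 3 ^ (2 * w * 3 ^ k + 1)) : Params ⟨inp, mem, B⟩ n w k m := by
  have hk : k < 3 ^ k := Nat.lt_pow_self (by norm_num)
  have hd : (k + 3 ^ k) * w ≤ 2 * w * 3 ^ k := by nlinarith
  have hdX : (k + 3 ^ k) * w < 3 ^ ((k + 3 ^ k) * w) := Nat.lt_pow_self (by norm_num)
  have hX : 3 ^ ((k + 3 ^ k) * w) ≤ 3 ^ (2 * w * 3 ^ k) := Nat.pow_le_pow_right (by norm_num) hd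
  have hkw : k + 3 ^ k ≤ (k + 3 ^ k) * w := Nat.le_mul_of_pos_right _ hw
  have hww : w ≤ (k + 3 ^ k) * w := Nat.le_mul_of_pos_left _ (by omega)
  have hE : 1 ≤ 3 ^ (2 * w * 3 ^ k) := Nat.one_le_pow _ _ (by norm_num)
  have hrow : (3 ^ ((k + 3 ^ k) * w) + n + 1) * m ≤ B := by
    rw [hB, pow_succ 3, sq]
    -- Each of the three summands is at most `m * 3 ^ (2 * w * 3 ^ k)`; this is the purpose of the
    -- `+ 1` in the exponent of `B`. The second factor `m` counts the rows.
    have h1 : 3 ^ ((k + 3 ^ k) * w) + n + 1 ≤ m * (3 ^ (2 * w * 3 ^ k) * 3) := by nlinarith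
    calc _ ≤ m * (3 ^ (2 * w * 3 ^ k) * 3) * m := Nat.mul_le_mul_right _ h1
      _ = _ := by ring
  have hle : 3 ^ ((k + 3 ^ k) * w) + n + 1 ≤ B := (Nat.le_mul_of_pos_right _ hm).trans hrow
  exact ⟨h0, h1, h2, h3, by dsimp only; omega, by dsimp only; omega, by dsimp only; omega,
    by dsimp only; omega, by dsimp only; omega, by dsimp only; omega, hrow⟩

/-- The correct row `g` may vary with the entry `j`, because each entry is computed from a different
truncation of the memory. -/
theorem IsRow.of_forall {n w : ℕ} {G : SimpleGraph (Fin n)} {cl lo k : ℕ} {Ψ : CWExpr (Fin n) w}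
    {f : ℕ → ℕ} (h : ∀ j < 3 ^ ((k + 3 ^ k) * w) + n + 1, ∃ g, IsRow G cl lo k g Ψ ∧ f j = g j) :
    IsRow G cl lo k f Ψ where
  states x hx := by
    obtain ⟨g, hg, e⟩ := h x (by omega)
    rw [e, hg.states x hx]
  labels v := by
    obtain ⟨g, hg, e⟩ := h _ (show 3 ^ ((k + 3 ^ k) * w) + (v : ℕ) < _ by omega)
    rw [e, hg.labels]
  size := by
    obtain ⟨g, hg, e⟩ := h _ (show 3 ^ ((k + 3 ^ k) * w) + n < _ by omega)
    rw [e, hg.size]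

open Tm

theorem eval_stepT {M : Mach} {n w k m cl lo p j : ℕ} (hp : Params M n w k m)
    (hj : j < 3 ^ ((k + 3 ^ k) * w) + n + 1)
    (hq : (3 ^ ((k + 3 ^ k) * w) + n + 1) * p + j ≤ M.bd) :
    (stepT cl lo).eval M [(3 ^ ((k + 3 ^ k) * w) + n + 1) * p + j] [] =
      (stepBody cl lo).eval M [p, j] [] := by
  set L := 3 ^ ((k + 3 ^ k) * w) + n + 1 with hL
  have hdiv : (div (var 0) rowT).eval M [L * p + j] [] = p := by
    rw [eval_div (by exact hq) (by rw [eval_rowT hp]; omega), eval_rowT hp, eval_var_zero,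
      Nat.mul_add_div (by omega), Nat.div_eq_of_lt hj, add_zero]
  have hpb : p ≤ M.bd := by
    have : p ≤ L * p := Nat.le_mul_of_pos_left _ (by omega)
    omega
  rw [stepT, eval_call₂, eval_sub, eval_mul (by rw [hdiv]; exact hpb), hdiv, eval_rowT hp,
    eval_var_zero, Nat.add_sub_cancel_left]

/-- A subexpression occupies consecutive operations starting at an offset `o`, and its row belongs
to the last of them. Induction over subexpressions requires arbitrary offsets, as the right side of
a union starts where the left one ends. -/
theorem isRow_table {n w k m cl lo B : ℕ} {G : SimpleGraph (Fin n)} {inp T : ℕ → ℕ}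
    (hp : ∀ mem, Params ⟨inp, mem, B⟩ n w k m)
    (hG : ∀ u v : Fin n, inp (4 + (3 * m + (n * u + v))) ≠ 0 ↔ G.Adj u v)
    (hT : ∀ q < B, T q =
      (stepT cl lo).eval ⟨inp, fun x => if x < q then T x else 0, B⟩ [q] []) :
    ∀ (Ψ : CWExpr (Fin n) w) (o : ℕ), Ψ.Uniform G → o + Ψ.size ≤ m →
      (∀ i < 3 * Ψ.size, inp (4 + (3 * o + i)) = Ψ.encode.getD i 0) →
      IsRow G cl lo k (row n w k T (o + Ψ.size - 1)) Ψ := by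
  set L := 3 ^ ((k + 3 ^ k) * w) + n + 1 with hL
  have hLm : L * m ≤ B := (hp T).table_le
  have hmB : m ≤ B := (Nat.le_mul_of_pos_left _ (Nat.succ_pos _)).trans hLm
  -- While row `p` is computed, all earlier rows are complete in the truncated memory, so
  -- correctness of rows `p' < p` carries over to it.
  have key : ∀ (p : ℕ) (Ψ : CWExpr (Fin n) w), p < m →
      (∀ M : Mach, M.inp = inp → M.bd = B → (∀ (p' : ℕ) (Φ : CWExpr (Fin n) w), p' < p →
        IsRow G cl lo k (row n w k T p') Φ → IsRow G cl lo k (row n w k M.mem p') Φ) →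
        IsRow G cl lo k (fun j => (stepBody cl lo).eval M [p, j] []) Ψ) →
      IsRow G cl lo k (row n w k T p) Ψ := by
    intro p Ψ hpm h
    refine IsRow.of_forall fun j hj => ⟨_, h ⟨inp, fun x => if x < L * p + j then T x else 0, B⟩
      rfl rfl fun p' Φ hp' hΦ => IsRow.of_forall fun i hi => ⟨_, hΦ, ?_⟩, ?_⟩
    · have : L * (p' + 1) ≤ L * p := Nat.mul_le_mul_left _ hp'
      exact if_pos (by rw [← hL] at hi ⊢; rw [Nat.mul_succ] at this; omega)
    · have : L * (p + 1) ≤ L * m := Nat.mul_le_mul_left _ hpm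
      have hq : L * p + j < B := by rw [Nat.mul_succ] at this; rw [← hL] at hj; omega
      rw [row, ← hL, hT _ hq, eval_stepT (hp _) hj hq.le]
  intro Ψ
  induction Ψ with
  | vertex v i =>
    intro o _ ho hi
    refine key _ _ ho fun M hM hB _ => ?_
    obtain ⟨_, _, _⟩ := M
    subst hM hB
    exact isRow_vertex (hp _) (hi 0 (by simp [CWExpr.size]))
      (hi 1 (by simp [CWExpr.size])) (hi 2 (by simp [CWExpr.size]))
  | relabel i j hij Ψ ih =>
    intro o hu ho hi
    rw [CWExpr.size] at hi
    have hop : ∀ r < 3, inp (4 + (3 * (o + Ψ.size) + r)) = [2, (i : ℕ), (j : ℕ)].getD r 0 := by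
      intro r hr
      rw [mul_add, add_assoc, hi _ (by omega), CWExpr.encode, List.getD_append_right _ _ _ _
        (by rw [CWExpr.length_encode]; omega), CWExpr.length_encode, Nat.add_sub_cancel_left]
    have hs := Ψ.size_pos
    have hr := ih o hu (Nat.le_of_succ_le ho) fun t ht => by
      rw [hi t (by omega), CWExpr.encode, List.getD_append _ _ _ _ (by rwa [CWExpr.length_encode])]
    refine key (o + Ψ.size) _ ho fun M hM hB hrow => ?_
    have hr' := hrow _ _ (by omega) hr
    obtain ⟨_, _, _⟩ := M
    subst hM hB
    exact isRow_relabel (hp _) (show _ ≤ _ from (Nat.le_of_succ_le ho).trans hmB) hij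
      (hop 0 (by decide)) (hop 1 (by decide)) (hop 2 (by decide)) hr'
  | join i j hij Ψ ih =>
    intro o hu ho hi
    rw [CWExpr.size] at hi
    have hop : inp (4 + (3 * (o + Ψ.size) + 0)) = 3 := by
      rw [mul_add, add_assoc, hi _ (by omega), CWExpr.encode, List.getD_append_right _ _ _ _
        (by rw [CWExpr.length_encode]; omega), CWExpr.length_encode, Nat.add_sub_cancel_left]
      rfl
    have hs := Ψ.size_pos
    have hr := ih o hu (Nat.le_of_succ_le ho) fun t ht => by
      rw [hi t (by omega), CWExpr.encode, List.getD_append _ _ _ _ (by rwa [CWExpr.length_encode])]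
    refine key (o + Ψ.size) _ ho fun M hM hB hrow => ?_
    have hr' := hrow _ _ (by omega) hr
    obtain ⟨_, _, _⟩ := M
    subst hM hB
    exact isRow_join (hp _) (show _ ≤ _ from (Nat.le_of_succ_le ho).trans hmB) hij hop hr'
  | union Φ Ψ ih ih' =>
    rintro o ⟨hu, hu', hd, R, hR⟩ ho hi
    rw [CWExpr.size] at hi ho
    have hle : 3 * (o + (Φ.size + Ψ.size)) = 3 * o + (3 * Φ.size + 3 * Ψ.size) := by ring
    have hop : inp (4 + (3 * (o + (Φ.size + Ψ.size)) + 0)) = 1 := by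
      rw [hle, add_assoc, hi _ (by omega), CWExpr.encode, List.getD_append_right _ _ _ _
        (by rw [List.length_append, CWExpr.length_encode, CWExpr.length_encode]; omega),
        List.length_append, CWExpr.length_encode, CWExpr.length_encode, Nat.add_sub_cancel_left]
      rfl
    have hs := Φ.size_pos
    have hs' := Ψ.size_pos
    have hl := ih o hu (by omega) fun t ht => by
      rw [hi t (by omega), CWExpr.encode, List.append_assoc,
        List.getD_append _ _ _ _ (by rwa [CWExpr.length_encode])]
    have hr := ih' (o + Φ.size) hu' (by omega) fun t ht => by
      rw [mul_add, add_assoc, hi _ (by omega), CWExpr.encode, List.append_assoc,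
        List.getD_append_right _ _ _ _ (by rw [CWExpr.length_encode]; omega),
        CWExpr.length_encode, Nat.add_sub_cancel_left,
        List.getD_append _ _ _ _ (by rwa [CWExpr.length_encode])]
    refine key (o + (Φ.size + Ψ.size)) _ ho fun M hM hB hrow => ?_
    have hl' := hrow _ _ (by omega) hl
    have hr' := hrow _ _ (by omega) hr
    rw [show o + Φ.size - 1 = o + (Φ.size + Ψ.size) - 1 - Ψ.size by omega] at hl'
    rw [show o + Φ.size + Ψ.size - 1 = o + (Φ.size + Ψ.size) - 1 by omega] at hr'
    obtain ⟨_, _, _⟩ := M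
    subst hM hB
    exact isRow_union (hp _) (show _ ≤ _ from (Nat.le_of_succ_le ho).trans hmB) hG hop hr' hl' hd hR

/-- There is a conflict-free colouring of `G` with colours in `{lo, …, k}`, where vertices of colour
`0` are uncoloured. -/
def Colourable {V : Type*} (cl lo : ℕ) (G : SimpleGraph V) (k : ℕ) : Prop :=
  ∃ C : V → ℕ, (∀ v, lo ≤ C v ∧ C v ≤ k) ∧
    ∀ v, ∃ c < k, {u | Near cl G v u ∧ C u = c + 1}.ncard = 1

theorem holds_answerT {n w k cl lo : ℕ} {G : SimpleGraph (Fin n)} {Φ : CWExpr (Fin n) w}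
    (hΦ : Φ.Defines G) {M : Mach} (hp : Params M n w k Φ.size)
    (hr : IsRow G cl lo k (row n w k M.mem (Φ.size - 1)) Φ) :
    (answerT.eval M [] [] = 1 ↔ Colourable cl lo G k) ∧ answerT.eval M [] [] ≤ 1 := by
  have h : Holds M (ex stateT (conj (cell (prev mT) (var 0)) (call₁ goodBody (var 0)))) [] ↔
      Colourable cl lo G k := by
    have hmB : Φ.size - 1 ≤ M.bd := (Nat.sub_le _ _).trans
      ((Nat.le_mul_of_pos_left _ (Nat.succ_pos _)).trans hp.table_le)
    rw [Colourable, ← exists_goodState_iff (l := Φ.lab) (w := w)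
      (fun v => by rw [ne_eq, CWExpr.lab_eq_zero]; exact hΦ.2.1 v) Φ.lab_le,
      holds_ex (fun _ => eval_stateT hp) hp.states_le]
    refine exists_congr fun x => and_congr_right fun hx => ?_
    have hprev : (prev mT).eval M [x] [] = Φ.size - 1 := by rw [eval_prev, eval_mT hp]
    rw [holds_conj, Holds, eval_cell hp (by rw [hprev]; exact hmB), hprev, holds_call₁]
    exact and_congr (hr.states x hx) (holds_goodBody hp (hx.le.trans hp.states_le))
  rw [← h, answerT, eval_neg, eval_neg, Holds]
  constructor
  · split_ifs with h h' h' <;> simp_all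
  · split_ifs <;> simp

theorem exists_decidesWithin (cl lo : ℕ) : ∃ D, ∀ (n w k : ℕ) (G : SimpleGraph (Fin n))
    (Φ : CWExpr (Fin n) w), Φ.Defines G →
      DecidesWithin (tableProg (stepT cl lo) answerT) (encodeInstance G Φ k)
        ((Φ.size ^ 2 * 3 ^ (2 * w * 3 ^ k + 1) + 2) ^ D) (Colourable cl lo G k) := by
  obtain ⟨D, hD⟩ := run_tableProg (stepT cl lo) answerT
  refine ⟨D, fun n w k G Φ hΦ => ?_⟩
  obtain ⟨h0, h1, h2, h3⟩ := encodeInstance_params G Φ k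
  obtain ⟨s, T, ⟨t, ht, hrun⟩, hT, hs⟩ := hD (encodeInstance G Φ k) w k Φ.size _ h1 h2 h3
    Φ.pos_of_expr Φ.size_pos rfl
  have hp : ∀ mem, Params ⟨fun i => (encodeInstance G Φ k).getD i 0, mem,
      Φ.size ^ 2 * 3 ^ (2 * w * 3 ^ k + 1)⟩ n w k Φ.size := fun mem =>
    Params.of_bound h0 h1 h2 h3 hΦ.card_le_size Φ.pos_of_expr Φ.size_pos rfl
  have hr := isRow_table hp (encodeInstance_graph G Φ k) hT Φ 0 hΦ.uniform (by simp) fun i hi => by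
    rw [mul_zero, zero_add, encodeInstance_expr G Φ k hi]
  rw [zero_add] at hr
  obtain ⟨ha, ha'⟩ := holds_answerT hΦ (hp T) hr
  rw [← hs] at ha ha'
  refine ⟨s, t, hrun, ht, ?_⟩
  by_cases h : Colourable cl lo G k
  · exact Or.inl ⟨h, ha.2 h⟩
  · exact Or.inr ⟨h, by have := mt ha.1 h; omega⟩

/-! ### Time bounds -/

theorem DecidesWithin.mono {P : Prog} {input : List ℕ} {T T' : ℕ} {Q Q' : Prop}
    (h : DecidesWithin P input T Q) (hT : T ≤ T') (hQ : Q ↔ Q') : DecidesWithin P input T' Q' :=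
  let ⟨s, t, hrun, ht, ha⟩ := h
  ⟨s, t, hrun, ht.trans hT, by rwa [← hQ]⟩

/-- With `W = w * 3 ^ k`, the estimates `3 ^ 2 ≤ 2 ^ 4` and `3 ≤ 4` give `2 ^ (4 * W + 2)`. One more
factor 2 absorbs the summand 2, and `W ≥ 1` turns `4 * W + 3` into `7 * W`. -/
theorem time_le (D : ℕ) {m w k : ℕ} (hm : 1 ≤ m) (hw : 1 ≤ w) :
    (m ^ 2 * 3 ^ (2 * w * 3 ^ k + 1) + 2) ^ D ≤ 2 ^ (7 * D * (w * 3 ^ k)) * m ^ (7 * D) := by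
  have hK : 1 ≤ 3 ^ k := Nat.one_le_pow _ _ (by norm_num)
  set W := w * 3 ^ k with hW
  have hW1 : 1 ≤ W := Nat.mul_pos hw hK
  have h1 : 1 ≤ m ^ 2 := Nat.one_le_pow _ _ hm
  have h2 : 3 ^ (2 * w * 3 ^ k + 1) ≤ 2 ^ (4 * W + 2) := by
    calc 3 ^ (2 * w * 3 ^ k + 1) = (3 ^ 2) ^ W * 3 := by rw [hW, ← pow_mul, pow_succ, mul_assoc]
      _ ≤ (2 ^ 4) ^ W * 4 :=
          Nat.mul_le_mul (Nat.pow_le_pow_left (by norm_num) W) (by norm_num)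
      _ = _ := by rw [← pow_mul, pow_add]; norm_num
  have h3 : 1 ≤ 2 ^ (4 * W) := Nat.one_le_pow _ _ (by norm_num)
  have h4 : m ^ 2 * 3 ^ (2 * w * 3 ^ k + 1) + 2 ≤ 2 ^ (7 * W) * m ^ 2 :=
    calc m ^ 2 * 3 ^ (2 * w * 3 ^ k + 1) + 2
        ≤ m ^ 2 * 2 ^ (4 * W + 2) + 2 := Nat.add_le_add_right (Nat.mul_le_mul_left _ h2) 2
      _ ≤ m ^ 2 * 2 ^ (4 * W + 3) := by
          have := Nat.mul_le_mul h1 h3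
          have h5 : m ^ 2 * 2 ^ (4 * W + 2) = 4 * (m ^ 2 * 2 ^ (4 * W)) := by ring
          have h6 : m ^ 2 * 2 ^ (4 * W + 3) = 8 * (m ^ 2 * 2 ^ (4 * W)) := by ring
          omega
      _ ≤ m ^ 2 * 2 ^ (7 * W) :=
          Nat.mul_le_mul_left _ (Nat.pow_le_pow_right (by norm_num) (by omega))
      _ = _ := mul_comm _ _
  calc _ ≤ (2 ^ (7 * W) * m ^ 2) ^ D := Nat.pow_le_pow_left h4 D
    _ = 2 ^ (7 * D * W) * m ^ (2 * D) := by rw [mul_pow, ← pow_mul, ← pow_mul]; congr 2; ring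
    _ ≤ _ := Nat.mul_le_mul_left _ (Nat.pow_le_pow_right hm (by omega))

/-- The factors `b` and `w ^ 2` are absorbed by the exponential: `b ≤ 2 ^ (b * W)` and `w ≤ 2 ^ W`
with `W = w * 3 ^ k ≥ 1`. -/
theorem time_le_of_size_le {b c m n w k : ℕ} (hm : 1 ≤ m) (hw : 1 ≤ w)
    (h : m ≤ b * (n * w ^ 2)) :
    2 ^ (c * (w * 3 ^ k)) * m ^ c ≤
      2 ^ ((c + b * c + 2 * c) * (w * 3 ^ k)) * n ^ (c + b * c + 2 * c) := by
  have hK : 1 ≤ 3 ^ k := Nat.one_le_pow _ _ (by norm_num)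
  have hn : 1 ≤ n := by
    rcases Nat.eq_zero_or_pos n with rfl | hn
    · simp at h; omega
    · exact hn
  set W := w * 3 ^ k with hW
  have hW1 : 1 ≤ W := Nat.mul_pos hw hK
  have hwW : w ≤ W := Nat.le_mul_of_pos_right _ hK
  have hb : b ≤ 2 ^ (b * W) :=
    Nat.lt_two_pow_self.le.trans (Nat.pow_le_pow_right (by norm_num)
      (Nat.le_mul_of_pos_right _ hW1))
  have hw2 : w ≤ 2 ^ W := Nat.lt_two_pow_self.le.trans (Nat.pow_le_pow_right (by norm_num) hwW)
  calc 2 ^ (c * W) * m ^ c ≤ 2 ^ (c * W) * (2 ^ (b * W) * (n * (2 ^ W) ^ 2)) ^ c :=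
        Nat.mul_le_mul_left _ (Nat.pow_le_pow_left (h.trans (Nat.mul_le_mul hb
          (Nat.mul_le_mul_left _ (Nat.pow_le_pow_left hw2 2)))) c)
    _ = 2 ^ ((c + b * c + 2 * c) * W) * n ^ c := by
        rw [mul_pow, mul_pow, ← pow_mul, ← pow_mul, ← pow_mul, add_mul, add_mul, pow_add, pow_add]
        ring
    _ ≤ _ := Nat.mul_le_mul_left _ (Nat.pow_le_pow_right hn (by omega))

theorem decidableWithExpression_of_le_iff {χ : ∀ {n : ℕ}, SimpleGraph (Fin n) → ℕ∞} (cl lo : ℕ)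
    (hχ : ∀ {n : ℕ} (G : SimpleGraph (Fin n)) (k : ℕ), χ G ≤ k ↔ Colourable cl lo G k) :
    DecidableWithExpression χ := by
  obtain ⟨D, hD⟩ := exists_decidesWithin cl lo
  refine ⟨tableProg (stepT cl lo) answerT, ⟨7 * D, fun n w k G Φ hΦ => ?_⟩,
    fun b => ⟨7 * D + b * (7 * D) + 2 * (7 * D), fun n w k G Φ hΦ hb => ?_⟩⟩
  · exact (hD n w k G Φ hΦ).mono (time_le D Φ.size_pos Φ.pos_of_expr) (hχ G k).symm
  · exact (hD n w k G Φ hΦ).mono ((time_le D Φ.size_pos Φ.pos_of_expr).trans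
      (time_le_of_size_le Φ.size_pos Φ.pos_of_expr hb)) (hχ G k).symm

/-! ### From chromatic numbers to colourability with a given number of colours -/

theorem iInf_natCast_le_iff {P : ℕ → Prop} (hP : ∀ i j, i ≤ j → P i → P j) (k : ℕ) :
    (⨅ i ∈ {i | P i}, (i : ℕ∞)) ≤ k ↔ P k := by
  refine ⟨fun h => ?_, fun h => iInf₂_le k h⟩
  by_contra hk
  have : ((k + 1 : ℕ) : ℕ∞) ≤ ⨅ i ∈ {i | P i}, (i : ℕ∞) := le_iInf₂ fun i hi => by
    rw [Nat.cast_le]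
    by_contra hlt
    exact hk (hP i k (by omega) hi)
  have := this.trans h
  rw [Nat.cast_le] at this
  omega

section Chi

variable {V : Type*} (G : SimpleGraph V)

/-- Additional colours may stay unused. This monotonicity makes `χ G ≤ k` equivalent to
colourability with exactly `k` available colours. -/
theorem Colourable.mono {cl lo i j : ℕ} (hij : i ≤ j) :
    Colourable cl lo G i → Colourable cl lo G j :=
  fun ⟨C, hC, h⟩ => ⟨C, fun v => ⟨(hC v).1, (hC v).2.trans hij⟩,
    fun v => let ⟨c, hc, h1⟩ := h v; ⟨c, hc.trans_le hij, h1⟩⟩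

theorem exists_colour_iff {N : V → Set V} {cl : ℕ} (hN : ∀ v u, u ∈ N v ↔ Near cl G v u) (k : ℕ)
    (C : V → ℕ) (v : V) : (∃ i, 1 ≤ i ∧ i ≤ k ∧ (N v ∩ C ⁻¹' {i}).ncard = 1) ↔
      ∃ c < k, {u | Near cl G v u ∧ C u = c + 1}.ncard = 1 := by
  have h : ∀ i, N v ∩ C ⁻¹' {i} = {u | Near cl G v u ∧ C u = i} := fun i => by
    ext u; simp [hN]
  simp only [h]
  constructor
  · rintro ⟨i, h1, h2, h3⟩
    exact ⟨i - 1, by omega, by rwa [Nat.sub_add_cancel h1]⟩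
  · rintro ⟨c, hc, h⟩
    exact ⟨c + 1, by omega, by omega, h⟩

theorem exists_partial_iff {N : V → Set V} {cl : ℕ} (hN : ∀ v u, u ∈ N v ↔ Near cl G v u) (k : ℕ) :
    (∃ C, IsPartialColouring N k C) ↔ Colourable cl 0 G k := by
  simp only [IsPartialColouring, Colourable, exists_colour_iff G hN, Nat.zero_le, true_and]

theorem exists_full_iff {N : V → Set V} {cl : ℕ} (hN : ∀ v u, u ∈ N v ↔ Near cl G v u) (k : ℕ) :
    (∃ C, IsFullColouring N k C) ↔ Colourable cl 1 G k := by
  simp only [IsFullColouring, Colourable, exists_colour_iff G hN]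

theorem mem_openNbhd_iff (v u : V) : u ∈ openNbhd G v ↔ Near 0 G v u := by
  simp [openNbhd, Near]

theorem mem_closedNbhd_iff (v u : V) : u ∈ closedNbhd G v ↔ Near 1 G v u := by
  simp [closedNbhd, Near, eq_comm, or_comm]

theorem chiONStar_le_iff (k : ℕ) : chiONStar G ≤ k ↔ Colourable 0 0 G k := by
  simp only [chiONStar, exists_partial_iff G (mem_openNbhd_iff G)]
  exact iInf_natCast_le_iff (fun _ _ h => Colourable.mono G h) k

theorem chiCNStar_le_iff (k : ℕ) : chiCNStar G ≤ k ↔ Colourable 1 0 G k := by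
  simp only [chiCNStar, exists_partial_iff G (mem_closedNbhd_iff G)]
  exact iInf_natCast_le_iff (fun _ _ h => Colourable.mono G h) k

theorem chiON_le_iff (k : ℕ) : chiON G ≤ k ↔ Colourable 0 1 G k := by
  simp only [chiON, exists_full_iff G (mem_openNbhd_iff G)]
  exact iInf_natCast_le_iff (fun _ _ h => Colourable.mono G h) k

theorem chiCN_le_iff (k : ℕ) : chiCN G ≤ k ↔ Colourable 1 1 G k := by
  simp only [chiCN, exists_full_iff G (mem_closedNbhd_iff G)]
  exact iInf_natCast_le_iff (fun _ _ h => Colourable.mono G h) k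

end Chi

end CF

theorem theorem1 :
    CF.DecidableWithExpression (fun G => CF.chiONStar G) ∧
    CF.DecidableWithExpression (fun G => CF.chiCNStar G) ∧
    CF.DecidableWithExpression (fun G => CF.chiON G) ∧
    CF.DecidableWithExpression (fun G => CF.chiCN G) :=
  ⟨CF.decidableWithExpression_of_le_iff 0 0 CF.chiONStar_le_iff,
    CF.decidableWithExpression_of_le_iff 1 0 CF.chiCNStar_le_iff,
    CF.decidableWithExpression_of_le_iff 0 1 CF.chiON_le_iff,
    CF.decidableWithExpression_of_le_iff 1 1 CF.chiCN_le_iff⟩
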